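/- **Setting.** Let $k\ge 2$, $0\le l<k<n$, and let $\Omega\subset\mathbb R^n$ be bounded and open. Let $\sigma_m$ be the $m$-th elementary symmetric polynomial ($\sigma_0=1$), $\Gamma_k=\{\mu\in\mathbb R^n:\sigma_m(\mu)>0,\ 1\le m\le k\}$ and $\widetilde\Gamma_k=\{\kappa\in\mathbb R^n:(\sum_{j\ne i}\kappa_j)_{i}\in\Gamma_k\}$. For a function $u$ with $|Du|<1$ put $$g_{ij}=\delta_{ij}-u_iu_j,\qquad h_{ij}=\frac{u_{ij}}{\sqrt{1-|Du|^2}},\qquad H=g^{ij}h_{ij},\qquad \eta=Hg-h;$$ $\kappa[M_u]$ and $\lambda(\eta[M_u])$ denote the eigenvalues, with multiplicity, of $h$ and of $\eta$ with respect to $g$ (so $\kappa[M_u]$ are the principal curvatures of the graph $M_u$ of $u$ in Minkowski space $\mathbb R^{n,1}$). A function $u\in C^2(\Omega)\cap C^1(\overline\Omega)$ is *admissible* if $\sup_{\overline\Omega}|Du|<1$ and $\kappa[M_u]\in\widetilde\Gamma_k$ at every point of $\Omega$. Let $\psi=\psi(x,z)\in C^\infty(\overline\Omega\times\mathbb R)$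 with $\psi>0$ and $\psi_z\ge 0$, and consider the Dirichlet problem $$(*)\qquad \frac{\sigma_k}{\sigma_l}\big(\lambda(\eta[M_u])\big)=\psi(x,u)\ \text{ in }\Omega,\qquad u=0\ \text{ on }\partial\Omega .$$ Write $\tilde w=1/\sqrt{1-|Du|^2}$ on $\overline\Omega$. **Theorem.** 1. Let $K,M\in\mathbb R$ and $c>0$. There is a constant $C>0$, depending only on $n,k,l,K,c,M$, such that for all $\Omega,\psi$ as above and every admissible solution $u\in C^3(\Omega)\cap C^1(\overline\Omega)$ of $(*)$ with $|u|\le M$ on $\overline\Omega$, and with $|D_x\psi|\le K$ and $\psi\ge c$ on $\Omega\times[-M,M]$, $$\sup_{\overline\Omega}\tilde w\le C\Big(1+\sup_{\partial\Omega}\tilde w\Big).$$ 2. For every $\theta\in(0,1)$ there is $\theta_0\in(0,1)$, depending only on $n,k,l,K,c,M,\theta$, such that every $u$ as in part 1 (for any $\Omega,\psi$ as there) with $\sup_{\partial\Omega}|Du|\le 1-\theta$ satisfies $\sup_{\overline\Omega}|Du|\le 1-\theta_0$. 3. Suppose $\partial\Omega$ is smooth and $(*)$ has an admissible subsolution $\underline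 u\in C^2(\Omega)\cap C^1(\overline\Omega)$, that is, $\underline u$ is admissible, $\frac{\sigma_k}{\sigma_l}(\lambda(\eta[M_{\underline u}]))\ge\psi(x,\underline u)$ in $\Omega$ and $\underline u=0$ on $\partial\Omega$. Then there is $\theta_0\in(0,1)$, depending only on $n,k,l,\Omega,\psi,\underline u$, such that every admissible solution $u\in C^3(\Omega)\cap C^1(\overline\Omega)$ of $(*)$ satisfies $\sup_{\overline\Omega}|Du|\le 1-\theta_0$. -/

import Mathlib

open scoped ContDiff

namespace MinkowskiGraph

noncomputable section

/-! ### Symmetric functions and cones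

Unordered `n`-tuples of reals (lists of eigenvalues counted with multiplicity) are multisets, and
`σ_m` is `Multiset.esymm · m`. -/

/-- `Γ_k = {μ : σ_m(μ) > 0 for 1 ≤ m ≤ k}`. -/
def gammaCone (k : ℕ) : Set (Multiset ℝ) :=
  {μ | ∀ m : ℕ, 1 ≤ m → m ≤ k → 0 < μ.esymm m}

/-- The tuple `μ_i = ∑_{j ≠ i} κ_j = (∑_j κ_j) - κ_i`. -/
def complementarySums (κ : Multiset ℝ) : Multiset ℝ :=
  κ.map fun t => κ.sum - t

/-- The cone of all `κ` whose tuple `(∑_{j ≠ i} κ_j)_i` lies in `Γ_k`. -/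
def gammaTildeCone (k : ℕ) : Set (Multiset ℝ) :=
  {κ | complementarySums κ ∈ gammaCone k}

/-- The eigenvalues of the bilinear form `a` with respect to the metric `g`: the eigenvalues,
with multiplicity, of `g⁻¹ a`. -/
def eigenvaluesWrt {n : ℕ} (g a : Matrix (Fin n) (Fin n) ℝ) : Multiset ℝ :=
  (g⁻¹ * a).charpoly.roots

/-! ### Geometry of the graph of `u` in Minkowski space -/

/-- The Hessian `u_{ij}`. -/
def hessian {n : ℕ} (u : EuclideanSpace ℝ (Fin n) → ℝ) (x : EuclideanSpace ℝ (Fin n)) :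
    Matrix (Fin n) (Fin n) ℝ :=
  Matrix.of fun i j =>
    fderiv ℝ (fderiv ℝ u) x (EuclideanSpace.single i 1) (EuclideanSpace.single j 1)

/-- The induced metric `g_{ij} = δ_{ij} - u_i u_j`. -/
def metric {n : ℕ} (u : EuclideanSpace ℝ (Fin n) → ℝ) (x : EuclideanSpace ℝ (Fin n)) :
    Matrix (Fin n) (Fin n) ℝ :=
  Matrix.of fun i j => (if i = j then 1 else 0) - gradient u x i * gradient u x j

/-- The second fundamental form `h_{ij} = u_{ij} / √(1 - |Du|²)` with respect to the upward unit
normal. -/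
def secondFundamentalForm {n : ℕ} (u : EuclideanSpace ℝ (Fin n) → ℝ)
    (x : EuclideanSpace ℝ (Fin n)) : Matrix (Fin n) (Fin n) ℝ :=
  Matrix.of fun i j => hessian u x i j / √(1 - ‖gradient u x‖ ^ 2)

/-- The principal curvatures `κ[M_u]`: the eigenvalues of `h` with respect to `g`. -/
def principalCurvatures {n : ℕ} (u : EuclideanSpace ℝ (Fin n) → ℝ)
    (x : EuclideanSpace ℝ (Fin n)) : Multiset ℝ :=
  eigenvaluesWrt (metric u x) (secondFundamentalForm u x)

/-- The (unnormalized) mean curvature `H = g^{ij} h_{ij} = κ_1 + ⋯ + κ_n`. -/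
def meanCurvature {n : ℕ} (u : EuclideanSpace ℝ (Fin n) → ℝ)
    (x : EuclideanSpace ℝ (Fin n)) : ℝ :=
  ((metric u x)⁻¹ * secondFundamentalForm u x).trace

/-- The tensor `η = H g - h`. -/
def etaTensor {n : ℕ} (u : EuclideanSpace ℝ (Fin n) → ℝ)
    (x : EuclideanSpace ℝ (Fin n)) : Matrix (Fin n) (Fin n) ℝ :=
  meanCurvature u x • metric u x - secondFundamentalForm u x

/-- The curvature function `(σ_k / σ_l)(λ(η[M_u]))`. -/
def quotientCurvature {n : ℕ} (k l : ℕ) (u : EuclideanSpace ℝ (Fin n) → ℝ)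
    (x : EuclideanSpace ℝ (Fin n)) : ℝ :=
  (eigenvaluesWrt (metric u x) (etaTensor u x)).esymm k /
    (eigenvaluesWrt (metric u x) (etaTensor u x)).esymm l

/-! ### Regularity up to the boundary -/

/-- The gradient of `u` on `closure Ω`: on `∂Ω` it is the limit of `Du` from inside `Ω`. -/
def gradBar {n : ℕ} (Ω : Set (EuclideanSpace ℝ (Fin n))) (u : EuclideanSpace ℝ (Fin n) → ℝ) :
    EuclideanSpace ℝ (Fin n) → EuclideanSpace ℝ (Fin n) :=
  extendFrom Ω (gradient u)

/-- `u ∈ C¹(closure Ω)`: `u` is `C¹` in `Ω`, and `u` and `Du` extend continuously to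
`closure Ω` (the extension of `u` being `u` itself). -/
structure IsC1UpToBoundary {n : ℕ} (Ω : Set (EuclideanSpace ℝ (Fin n)))
    (u : EuclideanSpace ℝ (Fin n) → ℝ) : Prop where
  contDiffOn : ContDiffOn ℝ 1 u Ω
  continuousOn : ContinuousOn u (closure Ω)
  exists_limit : ∀ x ∈ closure Ω, ∃ p, Filter.Tendsto (gradient u) (nhdsWithin x Ω) (nhds p)

/-- The function `1 / √(1 - |Du|²)` on `closure Ω`. -/
def wTilde {n : ℕ} (Ω : Set (EuclideanSpace ℝ (Fin n))) (u : EuclideanSpace ℝ (Fin n) → ℝ)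
    (x : EuclideanSpace ℝ (Fin n)) : ℝ :=
  1 / √(1 - ‖gradBar Ω u x‖ ^ 2)

/-- `∂Ω` is smooth: near each of its points `Ω` is the sublevel set `{ρ < 0}` of a smooth function
`ρ` with non-vanishing differential at the point. -/
def HasSmoothBoundary {n : ℕ} (Ω : Set (EuclideanSpace ℝ (Fin n))) : Prop :=
  ∀ p ∈ frontier Ω, ∃ ρ : EuclideanSpace ℝ (Fin n) → ℝ, ContDiff ℝ ∞ ρ ∧ fderiv ℝ ρ p ≠ 0 ∧
    ∀ᶠ x in nhds p, (x ∈ Ω ↔ ρ x < 0)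

/-! ### The Dirichlet problem -/

/-- `sup_{closure Ω} |Du| < 1`. -/
def IsSpacelike {n : ℕ} (Ω : Set (EuclideanSpace ℝ (Fin n)))
    (u : EuclideanSpace ℝ (Fin n) → ℝ) : Prop :=
  ∃ s < 1, ∀ x ∈ closure Ω, ‖gradBar Ω u x‖ ≤ s

/-- An admissible function of class `C²(Ω) ∩ C¹(closure Ω)`: it is spacelike and its graph is
`(η, k)`-convex. -/
structure IsAdmissible {n : ℕ} (k : ℕ) (Ω : Set (EuclideanSpace ℝ (Fin n)))
    (u : EuclideanSpace ℝ (Fin n) → ℝ) : Prop where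
  contDiffOn : ContDiffOn ℝ 2 u Ω
  isC1 : IsC1UpToBoundary Ω u
  spacelike : IsSpacelike Ω u
  convex : ∀ x ∈ Ω, principalCurvatures u x ∈ gammaTildeCone k

/-- `ψ = ψ(x, z) ∈ C^∞(closure Ω × ℝ)`, `ψ > 0` and `∂ψ/∂z ≥ 0`. -/
structure IsMonotoneSource {n : ℕ} (Ω : Set (EuclideanSpace ℝ (Fin n)))
    (ψ : EuclideanSpace ℝ (Fin n) × ℝ → ℝ) : Prop where
  smooth : ContDiffOn ℝ ∞ ψ (closure Ω ×ˢ Set.univ)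
  pos : ∀ x ∈ closure Ω, ∀ z : ℝ, 0 < ψ (x, z)
  deriv_nonneg : ∀ x ∈ Ω, ∀ z : ℝ, 0 ≤ deriv (fun t : ℝ => ψ (x, t)) z

/-- An admissible solution of `(σ_k / σ_l)(λ(η[M_u])) = ψ(x, u)` in `Ω`, `u = 0` on `∂Ω`. -/
structure IsAdmissibleSolution {n : ℕ} (k l : ℕ) (Ω : Set (EuclideanSpace ℝ (Fin n)))
    (ψ : EuclideanSpace ℝ (Fin n) × ℝ → ℝ) (u : EuclideanSpace ℝ (Fin n) → ℝ) : Prop where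
  admissible : IsAdmissible k Ω u
  equation : ∀ x ∈ Ω, quotientCurvature k l u x = ψ (x, u x)
  boundary : ∀ x ∈ frontier Ω, u x = 0

/-- An admissible subsolution: `(σ_k / σ_l)(λ(η[M_v])) ≥ ψ(x, v)` in `Ω`, `v = 0` on `∂Ω`. -/
structure IsAdmissibleSubsolution {n : ℕ} (k l : ℕ) (Ω : Set (EuclideanSpace ℝ (Fin n)))
    (ψ : EuclideanSpace ℝ (Fin n) × ℝ → ℝ) (v : EuclideanSpace ℝ (Fin n) → ℝ) : Prop where
  admissible : IsAdmissible k Ω v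
  inequality : ∀ x ∈ Ω, ψ (x, v x) ≤ quotientCurvature k l v x
  boundary : ∀ x ∈ frontier Ω, v x = 0

/-- The known data of the estimate: `|u| ≤ M` on `closure Ω`, and on `Ω × [-M, M]` the source
satisfies `|D_x ψ| ≤ K` and `ψ ≥ c`. -/
structure HasBounds {n : ℕ} (K c M : ℝ) (Ω : Set (EuclideanSpace ℝ (Fin n)))
    (ψ : EuclideanSpace ℝ (Fin n) × ℝ → ℝ) (u : EuclideanSpace ℝ (Fin n) → ℝ) : Prop where
  abs_le : ∀ x ∈ closure Ω, |u x| ≤ M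
  grad_le : ∀ x ∈ Ω, ∀ z : ℝ, |z| ≤ M → ‖gradient (fun y => ψ (y, z)) x‖ ≤ K
  le_source : ∀ x ∈ Ω, ∀ z : ℝ, |z| ≤ M → c ≤ ψ (x, z)

end

end MinkowskiGraph

/-! Interior estimate. Write p = Du, A = D²u, q = 1 - |p|², and let F(p, A) be the curvature
operator. Suppose log w + Bu, with w = q^(-1/2), has an interior maximum. The first-order condition
is A p = -Bq p, so the gradient is an eigenvector of the Hessian. With T the derivative of the
Hessian in the direction p, the second-order condition is T + A² + q(2B² p⊗p + BA) ≤ 0.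

Apply the linearization of F, which is nonnegative on positive semidefinite Hessian variations and
satisfies F_A(A) = (k-l)F by homogeneity. The eigenvector condition makes F_p · p computable: it
equals w²|p|²(k-l)F - 2w²Bq F_A(p⊗p). In the equation differentiated along p, the terms in F_A(p⊗p)
cancel exactly, the terms in F add up to -B(k-l)F because |p|² + q = 1, and F_A(A²) has the good
sign. The result is at most -Bc, while the source side is at least -K because ψ_z ≥ 0 and |p| < 1.
For Bc > K this is impossible, so w e^{Bu} is maximal on the boundary, where u = 0. Part 1 follows
with C = e^{BM}, and part 2 by solving for |Du|. The computation is in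
`AdmissiblePair.fderiv_gradient`, `AdmissiblePair.fderiv_le` and
`not_isLocalMax_log_lorentzFactor_add`.

Ellipticity is algebraic: along a rank one direction every σ_m is affine, and Newton's inequalities
on Γ_k make σ_k/σ_l increase (`sigma_add_smul_vecMulVec`). Positive semidefinite matrices are sums
of rank one matrices.

With a subsolution v, the trace condition gives u ≤ 0 and comparison gives v ≤ u (`subsolution_le`).
As both vanish on the smooth boundary, |Du| ≤ |Dv| there (`norm_gradBar_le_of_le`). Compactness
supplies K, c and M, and part 2 applies. -/

namespace MinkowskiGraph

/-! ### Newton inequalities and the cones Γ_k. -/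

section SymmetricFunctions

open Polynomial

/-- The Laguerre inequality for real-rooted polynomials. -/
theorem laguerre_inequality {p : ℝ[X]} (hp : p.Splits) (x : ℝ) :
    p.eval x * (derivative (derivative p)).eval x ≤ (derivative p).eval x ^ 2 := by
  induction hp using Submonoid.closure_induction with
  | mem p h =>
    rcases h with ⟨a, rfl⟩ | ⟨a, rfl⟩ <;> simp
  | one => simp
  | mul p q _ _ hp hq =>
    -- The defect p'² - pp'' of a product pq is q² times that of p plus p² times that of q.
    simp only [derivative_mul, derivative_add, eval_add, eval_mul]
    nlinarith [mul_nonneg (sub_nonneg.2 hp) (sq_nonneg (q.eval x)),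
      mul_nonneg (sub_nonneg.2 hq) (sq_nonneg (p.eval x))]

/-- Rolle's theorem with multiplicities: differentiation loses at most one real root, and it lowers
a positive degree. -/
theorem splits_derivative {p : ℝ[X]} (hp : p.Splits) : (derivative p).Splits := by
  rw [splits_iff_card_roots] at hp ⊢
  have h1 := card_roots_le_derivative p
  have h2 := natDegree_derivative_le p
  have h3 := card_roots' (derivative p)
  rcases Nat.eq_zero_or_pos p.natDegree with h0 | h0
  · omega
  · omega

theorem splits_iterate_derivative {p : ℝ[X]} (hp : p.Splits) (j : ℕ) :
    (derivative^[j] p).Splits := by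
  induction j with
  | zero => exact hp
  | succ j ih => rw [Function.iterate_succ_apply']; exact splits_derivative ih

/-- Laguerre's inequality at 0 for the j-th derivative, whose value, first and second derivatives at
0 are factorials times consecutive coefficients of p. -/
theorem newton_inequality_coeff {p : ℝ[X]} (hp : p.Splits) (j : ℕ) :
    ((j : ℝ) + 2) * (p.coeff j * p.coeff (j + 2)) ≤ (j + 1) * p.coeff (j + 1) ^ 2 := by
  have h := laguerre_inequality (splits_iterate_derivative hp j) 0
  have e0 : ∀ i, (derivative^[i] p).eval 0 = (i.factorial : ℝ) * p.coeff i := by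
    intro i
    rw [← coeff_zero_eq_eval_zero, coeff_iterate_derivative]
    simp [Nat.descFactorial_self]
  rw [← Function.iterate_succ_apply' derivative, ← Function.iterate_succ_apply' derivative,
    e0, e0, e0] at h
  simp only [Nat.factorial_succ, Nat.succ_eq_add_one, Nat.cast_mul, Nat.cast_add,
    Nat.cast_one] at h
  have hf : (0 : ℝ) < (j.factorial : ℝ) ^ 2 * (j + 1) := by positivity
  refine le_of_mul_le_mul_left ?_ hf
  calc _ = _ := ?_
    _ ≤ _ := h
    _ = _ := ?_
  · ring
  · ring

theorem esymm_cons (a : ℝ) (s : Multiset ℝ) (m : ℕ) :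
    (a ::ₘ s).esymm (m + 1) = s.esymm (m + 1) + a * s.esymm m := by
  simp only [Multiset.esymm, Multiset.powersetCard_cons, Multiset.map_add, Multiset.sum_add,
    Multiset.map_map, Function.comp_def, Multiset.prod_cons, Multiset.sum_map_mul_left]

theorem esymm_zero (s : Multiset ℝ) : s.esymm 0 = 1 := by
  simp [Multiset.esymm]

theorem esymm_eq_zero_of_card_lt (s : Multiset ℝ) {m : ℕ} (h : s.card < m) : s.esymm m = 0 := by
  simp [Multiset.esymm, Multiset.powersetCard_eq_empty _ h]

/-- The polynomial ∏(X + r) is real-rooted with coefficients σ_m in reverse order. The factor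
(i+1)/(i+2) < 1 in the coefficient inequality gives strictness when the product on the left is
positive. -/
theorem newton_inequality (s : Multiset ℝ) (j : ℕ) :
    s.esymm j * s.esymm (j + 2) ≤ s.esymm (j + 1) ^ 2 ∧
      (0 < s.esymm j * s.esymm (j + 2) → s.esymm j * s.esymm (j + 2) < s.esymm (j + 1) ^ 2) := by
  by_cases hj : j + 2 ≤ s.card
  · set p : ℝ[X] := (s.map fun r => X + C r).prod
    have hp : p.Splits := Splits.multisetProd (by
      intro f hf
      obtain ⟨a, -, rfl⟩ := Multiset.mem_map.1 hf
      exact Splits.X_add_C a)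
    obtain ⟨i, hi⟩ := Nat.exists_eq_add_of_le hj
    have hc : ∀ a b, a + b = s.card → p.coeff a = s.esymm b := by
      intro a b hab
      rw [Multiset.prod_X_add_C_coeff s (by omega)]
      congr 1; omega
    have h := newton_inequality_coeff hp i
    rw [hc i (j + 2) (by omega), hc (i + 1) (j + 1) (by omega), hc (i + 2) j (by omega)] at h
    have hi0 : (0 : ℝ) ≤ i := Nat.cast_nonneg i
    constructor
    · by_contra hcon
      push Not at hcon
      nlinarith [sq_nonneg (s.esymm (j + 1))]
    · intro hpos
      by_contra hcon
      push Not at hcon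
      nlinarith [sq_nonneg (s.esymm (j + 1))]
  · rw [esymm_eq_zero_of_card_lt s (m := j + 2) (by omega)]
    exact ⟨by simpa using sq_nonneg _, by simp⟩

/-- Deleting an entry of a tuple in `Γ_k` gives a tuple in `Γ_{k-1}`. -/
theorem esymm_pos_of_cons_mem_gammaCone {a : ℝ} {s : Multiset ℝ} {k : ℕ}
    (h : a ::ₘ s ∈ gammaCone k) : ∀ m < k, 0 < s.esymm m := by
  intro m
  induction m with
  | zero => intro _; simp [esymm_zero]
  | succ m ih =>
    intro hm
    have h0 := ih (by omega)
    have h1 := h (m + 1) (by omega) (by omega)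
    have h2 := h (m + 2) (by omega) (by omega)
    rw [esymm_cons] at h1 h2
    -- If σ_{m+1}(s) ≤ 0, then a > 0, and combining the two positivity relations yields σ_m σ_{m+2}
    -- > σ_{m+1}², against Newton.
    by_contra hcon
    push Not at hcon
    have hN := (newton_inequality s m).1
    have ha : 0 < a := by
      by_contra ha
      push Not at ha
      nlinarith
    nlinarith [mul_pos h2 h0, mul_nonneg (neg_nonneg.2 hcon) h1.le]

/-- Log-concavity: the ratios σ_{j+1}/σ_j strictly decrease, by chaining Newton's inequalities. The
top value σ_k may be nonpositive, in which case the claim is a comparison of signs. -/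
theorem esymm_mul_esymm_lt {s : Multiset ℝ} {k : ℕ} (h : ∀ m < k, 0 < s.esymm m) {l j : ℕ}
    (hlj : l + 1 ≤ j) (hjk : j + 1 ≤ k) :
    s.esymm (j + 1) * s.esymm l < s.esymm j * s.esymm (l + 1) := by
  induction j, hlj using Nat.le_induction with
  | base =>
    have h0 := h l (by omega)
    have h1 := h (l + 1) (by omega)
    rcases le_or_gt (s.esymm (l + 1 + 1)) 0 with h2 | h2
    · nlinarith [mul_pos h1 h1]
    · nlinarith [(newton_inequality s l).2 (mul_pos h0 h2)]
  | succ j hj ih =>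
    have ih := ih (by omega)
    have h0 := h l (by omega)
    have h1 := h (l + 1) (by omega)
    have h2 := h j (by omega)
    have h3 := h (j + 1) (by omega)
    rcases le_or_gt (s.esymm (j + 1 + 1)) 0 with h4 | h4
    · nlinarith [mul_pos h3 h1]
    · have hN := (newton_inequality s j).2 (mul_pos h2 h4)
      refine lt_of_mul_lt_mul_left ?_ h2.le
      calc s.esymm j * (s.esymm (j + 1 + 1) * s.esymm l)
          = (s.esymm j * s.esymm (j + 2)) * s.esymm l := by ring
        _ < s.esymm (j + 1) ^ 2 * s.esymm l := by gcongr
        _ = s.esymm (j + 1) * (s.esymm (j + 1) * s.esymm l) := by ring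
        _ < s.esymm (j + 1) * (s.esymm j * s.esymm (l + 1)) := by gcongr
        _ = _ := by ring

end SymmetricFunctions

/-! ### Symmetric functions of matrices and rank one perturbations. -/

section MatrixSymmetricFunctions

open Polynomial Matrix

variable {n : ℕ}

/-- The `m`-th elementary symmetric function of the eigenvalues of a matrix, as a coefficient of
its characteristic polynomial. -/
noncomputable def sigma (m : ℕ) (N : Matrix (Fin n) (Fin n) ℝ) : ℝ :=
  (-1) ^ m * N.charpoly.coeff (n - m)

theorem sigma_zero (N : Matrix (Fin n) (Fin n) ℝ) : sigma 0 N = 1 := by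
  have := N.charpoly_monic.coeff_natDegree
  rw [N.charpoly_natDegree_eq_dim, Fintype.card_fin] at this
  simp [sigma, this]

/-- The minors exhibit σ_m as a homogeneous polynomial in the entries, which gives smoothness and
scaling without any choice of eigenvalues. -/
theorem sigma_eq_sum_minors {m : ℕ} (hm : m ≤ n) (N : Matrix (Fin n) (Fin n) ℝ) :
    sigma m N = ∑ s ∈ Finset.univ.powersetCard m,
      (N.submatrix (Subtype.val : s → Fin n) (Subtype.val : s → Fin n)).det := by
  have h := charpoly_coeff_eq_sum_minors N m (by simpa using hm)
  rw [Fintype.card_fin] at h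
  rw [sigma, h, ← mul_assoc, ← mul_pow]
  simp

theorem sigma_one (hn : 1 ≤ n) (N : Matrix (Fin n) (Fin n) ℝ) : sigma 1 N = N.trace := by
  have : Nonempty (Fin n) := ⟨⟨0, hn⟩⟩
  rw [sigma, trace_eq_neg_charpoly_coeff, Fintype.card_fin]
  ring

theorem sigma_smul {m : ℕ} (hm : m ≤ n) (t : ℝ) (N : Matrix (Fin n) (Fin n) ℝ) :
    sigma m (t • N) = t ^ m * sigma m N := by
  rw [sigma_eq_sum_minors hm, sigma_eq_sum_minors hm, Finset.mul_sum]
  refine Finset.sum_congr rfl fun s hs => ?_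
  have : ((t • N).submatrix (Subtype.val : s → Fin n) (Subtype.val : s → Fin n))
      = t • (N.submatrix (Subtype.val : s → Fin n) (Subtype.val : s → Fin n)) := rfl
  rw [this, det_smul, Fintype.card_coe, (Finset.mem_powersetCard.1 hs).2]

theorem sigma_conj {P Q : Matrix (Fin n) (Fin n) ℝ} (h : Q * P = 1) (m : ℕ)
    (N : Matrix (Fin n) (Fin n) ℝ) : sigma m (P * N * Q) = sigma m N := by
  rw [sigma, charpoly_mul_comm, ← mul_assoc, h, one_mul, sigma]

theorem sigma_eq_esymm_roots {m : ℕ} (hm : m ≤ n) {N : Matrix (Fin n) (Fin n) ℝ}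
    (hN : N.charpoly.Splits) : sigma m N = N.charpoly.roots.esymm m := by
  have hd : N.charpoly.natDegree = n := by simp
  rw [sigma, coeff_eq_esymm_roots_of_splits hN (by omega), N.charpoly_monic.leadingCoeff, hd,
    Nat.sub_sub_self hm, one_mul, ← mul_assoc, ← mul_pow]
  simp

/-- The matrix determinant lemma. It is stated over a general field so that it can be used over
ℝ(X), where the diagonal entries X - d_i of a characteristic matrix never vanish, whatever the d_i
are. -/
theorem det_diagonal_add_vecMulVec_of_ne_zero {F : Type*} [Field F] (a u v : Fin n → F)
    (ha : ∀ i, a i ≠ 0) : (diagonal a + vecMulVec u v).det =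
      ∏ i, a i + ∑ i, u i * v i * ∏ j ∈ Finset.univ.erase i, a j := by
  have hu : IsUnit (diagonal a).det := by
    rw [det_diagonal]; exact (Finset.prod_ne_zero_iff.2 fun i _ => ha i).isUnit
  have h := det_add_replicateCol_mul_replicateRow (ι := Unit) hu u v
  have e : replicateCol Unit u * replicateRow Unit v = vecMulVec u v := by
    ext i j; simp [mul_apply, vecMulVec_apply]
  have hinv : (diagonal a)⁻¹ = diagonal (fun i => (a i)⁻¹) := by
    apply inv_eq_left_inv
    rw [diagonal_mul_diagonal, ← diagonal_one]
    congr 1; ext i; simp [ha i]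
  rw [e] at h
  rw [h, det_diagonal, det_unique, hinv]
  have e2 : (1 + replicateRow Unit v * diagonal (fun i => (a i)⁻¹) * replicateCol Unit u :
      Matrix Unit Unit F) default default = 1 + ∑ i, v i * (a i)⁻¹ * u i := by
    simp [mul_apply, diagonal_apply]
  rw [e2, mul_add, mul_one, Finset.mul_sum]
  congr 1
  refine Finset.sum_congr rfl fun i _ => ?_
  rw [← Finset.mul_prod_erase Finset.univ a (Finset.mem_univ i)]
  field_simp [ha i]

theorem charpoly_diagonal_add_smul_vecMulVec (d b : Fin n → ℝ) (t : ℝ) :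
    (diagonal d + t • vecMulVec b b).charpoly =
      ∏ i, (X - C (d i)) - ∑ i, C (t * (b i * b i)) * ∏ j ∈ Finset.univ.erase i, (X - C (d j)) := by
  apply IsFractionRing.injective ℝ[X] (RatFunc ℝ)
  set f := algebraMap ℝ[X] (RatFunc ℝ) with hf
  have hinj : Function.Injective f := IsFractionRing.injective ℝ[X] (RatFunc ℝ)
  rw [Matrix.charpoly, RingHom.map_det]
  have e : f.mapMatrix (diagonal d + t • vecMulVec b b).charmatrix =
      diagonal (fun i => f (X - C (d i))) +
        vecMulVec (fun i => f (-C (t * b i))) (fun i => f (C (b i))) := by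
    ext i j
    by_cases hij : i = j
    · subst hij
      simp [vecMulVec_apply]
      ring
    · simp [vecMulVec_apply, hij]
      ring
  rw [e, det_diagonal_add_vecMulVec_of_ne_zero]
  · simp only [map_sub, map_prod, map_sum, map_mul, map_neg]
    rw [sub_eq_add_neg, ← Finset.sum_neg_distrib]
    congr 1
    refine Finset.sum_congr rfl fun i _ => ?_
    ring
  · intro i
    rw [Ne, map_eq_zero_iff f hinj]
    exact X_sub_C_ne_zero _

theorem sigma_diagonal_add_smul_vecMulVec (d b : Fin n → ℝ) (t : ℝ) {m : ℕ} (hm : m + 1 ≤ n) :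
    sigma (m + 1) (diagonal d + t • vecMulVec b b) =
      (Finset.univ.val.map d).esymm (m + 1) +
        t * ∑ i, b i ^ 2 * ((Finset.univ.erase i).val.map d).esymm m := by
  have hp : ∀ s : Finset (Fin n), ∏ i ∈ s, (X - C (d i)) =
      ((s.val.map d).map fun r => X - C r).prod := by
    intro s; rw [Multiset.map_map]; rfl
  have h1 : (∏ i, (X - C (d i))).coeff (n - (m + 1)) =
      (-1) ^ (m + 1) * (Finset.univ.val.map d).esymm (m + 1) := by
    rw [hp, Multiset.prod_X_sub_C_coeff _ (by simp)]
    simp only [Multiset.card_map, Finset.card_val, Finset.card_univ, Fintype.card_fin]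
    rw [Nat.sub_sub_self hm]
  have h2 : ∀ i : Fin n, (∏ j ∈ Finset.univ.erase i, (X - C (d j))).coeff (n - (m + 1)) =
      (-1) ^ m * ((Finset.univ.erase i).val.map d).esymm m := by
    intro i
    rw [hp, Multiset.prod_X_sub_C_coeff _ (by simp; omega)]
    have : (n - 1) - (n - (m + 1)) = m := by omega
    simp only [Multiset.card_map, Finset.card_val, Finset.card_erase_of_mem (Finset.mem_univ i),
      Finset.card_univ, Fintype.card_fin, this]
  rw [sigma, charpoly_diagonal_add_smul_vecMulVec, coeff_sub, h1, finsetSum_coeff]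
  simp only [coeff_C_mul, h2]
  have hs : ((-1 : ℝ) ^ m) * (-1) ^ m = 1 := by rw [← mul_pow]; simp
  rw [mul_sub, ← mul_assoc, pow_succ, Finset.mul_sum, Finset.mul_sum, sub_eq_add_neg,
    ← Finset.sum_neg_distrib]
  congr 1
  · linear_combination (Finset.univ.val.map d).esymm (m + 1) * hs
  · refine Finset.sum_congr rfl fun i _ => ?_
    linear_combination (t * b i ^ 2 * ((Finset.univ.erase i).val.map d).esymm m) * hs

/-- `N` belongs to the matrix cone over `Γ_k`. -/
def IsGamma (k : ℕ) (N : Matrix (Fin n) (Fin n) ℝ) : Prop :=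
  ∀ m : ℕ, 1 ≤ m → m ≤ k → 0 < sigma m N

theorem IsGamma.sigma_pos {k m : ℕ} {N : Matrix (Fin n) (Fin n) ℝ} (h : IsGamma k N)
    (hm : m ≤ k) : 0 < sigma m N := by
  rcases Nat.eq_zero_or_pos m with rfl | h0
  · rw [sigma_zero]; exact one_pos
  · exact h m h0 hm

/-- In a rank one direction all `σ_m` are affine, and `σ_k / σ_l` is increasing. -/
theorem sigma_add_smul_vecMulVec {k l : ℕ} (hlk : l < k) (hkn : k ≤ n)
    {N : Matrix (Fin n) (Fin n) ℝ} (hN : N.IsSymm) (hG : IsGamma k N) (b : Fin n → ℝ) :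
    ∃ τ : ℕ → ℝ, (∀ m ≤ k, ∀ t : ℝ, sigma m (N + t • vecMulVec b b) = sigma m N + t * τ m) ∧
      (∀ m ≤ k, 0 ≤ τ m) ∧ sigma k N * τ l ≤ τ k * sigma l N ∧
      (b ≠ 0 → sigma k N * τ l < τ k * sigma l N) := by
  have hH : N.IsHermitian := by
    rw [IsHermitian, conjTranspose_eq_transpose_of_trivial]; exact hN
  set U : Matrix (Fin n) (Fin n) ℝ := (hH.eigenvectorUnitary : Matrix (Fin n) (Fin n) ℝ)
  set d : Fin n → ℝ := hH.eigenvalues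
  have hUU : Uᵀ * U = 1 := by
    have := Unitary.coe_star_mul_self hH.eigenvectorUnitary
    simpa [star_eq_conjTranspose] using this
  have hUU' : U * Uᵀ = 1 := by
    have := Unitary.coe_mul_star_self hH.eigenvectorUnitary
    simpa [star_eq_conjTranspose] using this
  have hNd : N = U * diagonal d * Uᵀ := by
    have := hH.spectral_theorem
    rw [Unitary.conjStarAlgAut_apply] at this
    simpa [star_eq_conjTranspose] using this
  set c := Uᵀ *ᵥ b
  have hb : b = U *ᵥ c := by simp [c, hUU']
  have hvb : vecMulVec b b = U * vecMulVec c c * Uᵀ := by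
    rw [mul_vecMulVec, vecMulVec_mul, vecMul_transpose, ← hb]
  have key : ∀ m (t : ℝ), sigma m (N + t • vecMulVec b b) =
      sigma m (diagonal d + t • vecMulVec c c) := by
    intro m t
    rw [hvb, hNd, ← sigma_conj hUU m (diagonal d + t • vecMulVec c c)]
    congr 1
    rw [mul_add, add_mul, Matrix.mul_smul, Matrix.smul_mul]
  set s : Multiset ℝ := Finset.univ.val.map d
  set r : Fin n → Multiset ℝ := fun i => (Finset.univ.erase i).val.map d
  have hsr : ∀ i, s = d i ::ₘ r i := by
    intro i
    simp only [s, r]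
    rw [← Multiset.map_cons, Finset.erase_val, Multiset.cons_erase (by simp)]
  have hσ : ∀ m, m + 1 ≤ n → sigma (m + 1) N = s.esymm (m + 1) := by
    intro m hm
    have h := key (m + 1) 0
    rw [sigma_diagonal_add_smul_vecMulVec d c 0 hm] at h
    rwa [zero_smul, add_zero, zero_mul, add_zero] at h
  have hs : s ∈ gammaCone k := by
    intro m h1 h2
    obtain ⟨m, rfl⟩ := Nat.exists_eq_add_of_le' h1
    rw [← hσ m (by omega)]
    exact hG _ h1 h2
  have hr : ∀ i, ∀ m < k, 0 < (r i).esymm m := by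
    intro i
    rw [hsr i] at hs
    exact esymm_pos_of_cons_mem_gammaCone hs
  set τ : ℕ → ℝ := fun m => match m with
    | 0 => 0
    | m + 1 => ∑ i, c i ^ 2 * (r i).esymm m
  have hcb : b ≠ 0 → ∃ i, c i ≠ 0 := by
    intro h
    by_contra hcon
    push Not at hcon
    apply h
    rw [hb, show c = 0 from funext hcon, mulVec_zero]
  obtain ⟨k, rfl⟩ := Nat.exists_eq_add_of_le' (show 1 ≤ k by omega)
  -- With s = d_i ::ₘ r_i, the terms containing d_i cancel in τ_k σ_l - σ_k τ_l. What remains for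
  -- each i is the log-concavity gap of r_i, which is positive because r_i comes from Γ_k by
  -- deletion.
  have hdiff : ∃ q : Fin n → ℝ, (∀ i, 0 < q i) ∧
      τ (k + 1) * sigma l N - sigma (k + 1) N * τ l = ∑ i, c i ^ 2 * q i := by
    rcases Nat.eq_zero_or_pos l with rfl | hl
    · refine ⟨fun i => (r i).esymm k, fun i => hr i k (by omega), ?_⟩
      simp [τ, sigma_zero]
    · obtain ⟨l, rfl⟩ := Nat.exists_eq_add_of_le' hl
      refine ⟨fun i => (r i).esymm k * (r i).esymm (l + 1) - (r i).esymm (k + 1) * (r i).esymm l,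
        fun i => sub_pos.2 (esymm_mul_esymm_lt (hr i) (by omega) le_rfl), ?_⟩
      simp only [τ]
      rw [Finset.sum_mul, Finset.mul_sum, ← Finset.sum_sub_distrib]
      refine Finset.sum_congr rfl fun i _ => ?_
      rw [hσ l (by omega), hσ k (by omega), hsr i, esymm_cons, esymm_cons]
      ring
  obtain ⟨q, hq, hqe⟩ := hdiff
  refine ⟨τ, ?_, ?_, ?_, ?_⟩
  · intro m hm t
    rcases m with _ | m
    · simp [sigma_zero, τ]
    · rw [key, sigma_diagonal_add_smul_vecMulVec d c t (by omega), hσ m (by omega)]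
  · intro m hm
    rcases m with _ | m
    · simp [τ]
    · exact Finset.sum_nonneg fun i _ => mul_nonneg (sq_nonneg _) (hr i m (by omega)).le
  · rw [← sub_nonneg, hqe]
    exact Finset.sum_nonneg fun i _ => mul_nonneg (sq_nonneg _) (hq i).le
  · intro h
    obtain ⟨i, hi⟩ := hcb h
    rw [← sub_pos, hqe]
    exact Finset.sum_pos' (fun i _ => mul_nonneg (sq_nonneg _) (hq i).le)
      ⟨i, Finset.mem_univ i, mul_pos (by positivity) (hq i)⟩

end MatrixSymmetricFunctions

/-! ### Ellipticity and homogeneity of σ_k/σ_l on symmetric matrices. -/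

section QuotientOperator

open Matrix
open scoped Matrix.Norms.Operator

variable {n : ℕ}

theorem contDiff_entry (i j : Fin n) :
    ContDiff ℝ 1 fun N : Matrix (Fin n) (Fin n) ℝ => N i j :=
  (LinearMap.toContinuousLinearMap (Matrix.entryLinearMap ℝ ℝ i j)).contDiff

theorem contDiffAt_matrix {V : Type*} [NormedAddCommGroup V] [NormedSpace ℝ V]
    {M : V → Matrix (Fin n) (Fin n) ℝ} {x : V} (h : ∀ i j, ContDiffAt ℝ 1 (fun y => M y i j) x) :
    ContDiffAt ℝ 1 M x := by
  have h1 : ContDiffAt ℝ 1 (fun y i j => M y i j) x :=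
    contDiffAt_pi.2 fun i => contDiffAt_pi.2 fun j => h i j
  exact (LinearMap.toContinuousLinearMap
    (Matrix.ofLinearEquiv ℝ : (Fin n → Fin n → ℝ) ≃ₗ[ℝ] _).toLinearMap).contDiff.contDiffAt.comp x h1

theorem hasDerivAt_matrix {M : ℝ → Matrix (Fin n) (Fin n) ℝ} {M' : Matrix (Fin n) (Fin n) ℝ}
    {t : ℝ} (h : ∀ i j, HasDerivAt (fun s => M s i j) (M' i j) t) : HasDerivAt M M' t := by
  have h1 : HasDerivAt (fun s i j => M s i j) (fun i j => M' i j) t :=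
    hasDerivAt_pi.2 fun i => hasDerivAt_pi.2 fun j => h i j
  exact (LinearMap.toContinuousLinearMap
    (Matrix.ofLinearEquiv ℝ : (Fin n → Fin n → ℝ) ≃ₗ[ℝ] _).toLinearMap).hasFDerivAt.comp_hasDerivAt
      t h1

theorem contDiff_det {ι : Type*} [Fintype ι] [DecidableEq ι] (e : ι → Fin n) :
    ContDiff ℝ 1 fun N : Matrix (Fin n) (Fin n) ℝ => (N.submatrix e e).det := by
  simp only [det_apply']
  exact ContDiff.sum fun σ _ => contDiff_const.mul
    (contDiff_prod fun i _ => contDiff_entry _ _)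

theorem contDiff_sigma {m : ℕ} (hm : m ≤ n) :
    ContDiff ℝ 1 (sigma m : Matrix (Fin n) (Fin n) ℝ → ℝ) := by
  rw [funext fun N => sigma_eq_sum_minors (n := n) hm N]
  exact ContDiff.sum fun s _ => contDiff_det _

/-- The quotient `σ_k / σ_l` of the eigenvalues of a matrix. -/
noncomputable def sigmaQuotient (k l : ℕ) (N : Matrix (Fin n) (Fin n) ℝ) : ℝ :=
  sigma k N / sigma l N

theorem IsGamma.add_vecMulVec {k l : ℕ} (hlk : l < k) (hkn : k ≤ n)
    {N : Matrix (Fin n) (Fin n) ℝ} (hN : N.IsSymm) (hG : IsGamma k N) (b : Fin n → ℝ) :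
    IsGamma k (N + vecMulVec b b) ∧ sigmaQuotient k l N ≤ sigmaQuotient k l (N + vecMulVec b b) := by
  obtain ⟨τ, h1, h2, h3, -⟩ := sigma_add_smul_vecMulVec hlk hkn hN hG b
  have h4 : ∀ m ≤ k, sigma m (N + vecMulVec b b) = sigma m N + τ m := by
    intro m hm
    simpa using h1 m hm 1
  refine ⟨fun m hm1 hmk => ?_, ?_⟩
  · rw [h4 m hmk]
    have := hG m hm1 hmk
    have := h2 m hmk
    positivity
  · have hl := hG.sigma_pos hlk.le
    have := h2 l hlk.le
    rw [sigmaQuotient, sigmaQuotient, h4 k le_rfl, h4 l hlk.le,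
      div_le_div_iff₀ hl (by positivity)]
    linarith

/-- Rank one summands are added one at a time and each partial sum stays in the cone, so convexity
of the cone is never needed. -/
theorem IsGamma.add_posSemidef {k l : ℕ} (hlk : l < k) (hkn : k ≤ n)
    {N S : Matrix (Fin n) (Fin n) ℝ} (hN : N.IsSymm) (hG : IsGamma k N) (hS : S.PosSemidef) :
    IsGamma k (N + S) ∧ sigmaQuotient k l N ≤ sigmaQuotient k l (N + S) := by
  obtain ⟨m, v, rfl⟩ := posSemidef_iff_eq_sum_vecMulVec.1 hS
  simp only [star_trivial]
  suffices h : ∀ s : Finset (Fin m), (N + ∑ i ∈ s, vecMulVec (v i) (v i)).IsSymm ∧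
      IsGamma k (N + ∑ i ∈ s, vecMulVec (v i) (v i)) ∧
      sigmaQuotient k l N ≤ sigmaQuotient k l (N + ∑ i ∈ s, vecMulVec (v i) (v i)) from
    (h Finset.univ).2
  intro s
  induction s using Finset.induction_on with
  | empty => simpa using ⟨hN, hG⟩
  | insert i s hi ih =>
    obtain ⟨ih1, ih2, ih3⟩ := ih
    have e : N + ∑ j ∈ insert i s, vecMulVec (v j) (v j) =
        N + ∑ j ∈ s, vecMulVec (v j) (v j) + vecMulVec (v i) (v i) := by
      rw [Finset.sum_insert hi]; abel
    rw [e]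
    have h := ih2.add_vecMulVec hlk hkn ih1 (v i)
    refine ⟨ih1.add ?_, h.1, ih3.trans h.2⟩
    rw [IsSymm, transpose_vecMulVec]

theorem IsGamma.contDiffAt_sigmaQuotient {k l : ℕ} (hlk : l < k) (hkn : k ≤ n)
    {N : Matrix (Fin n) (Fin n) ℝ} (hG : IsGamma k N) : ContDiffAt ℝ 1 (sigmaQuotient k l) N :=
  (contDiff_sigma hkn).contDiffAt.div (contDiff_sigma (by omega)).contDiffAt
    (hG.sigma_pos hlk.le).ne'

theorem IsGamma.hasFDerivAt_sigmaQuotient {k l : ℕ} (hlk : l < k) (hkn : k ≤ n)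
    {N : Matrix (Fin n) (Fin n) ℝ} (hG : IsGamma k N) :
    HasFDerivAt (sigmaQuotient k l) (fderiv ℝ (sigmaQuotient k l) N) N :=
  ((hG.contDiffAt_sigmaQuotient hlk hkn).differentiableAt one_ne_zero).hasFDerivAt

theorem hasDerivAt_comp_line {V : Type*} [NormedAddCommGroup V] [NormedSpace ℝ V]
    {f : V → ℝ} {f' : V →L[ℝ] ℝ} {x : V} (h : HasFDerivAt f f' x) (v : V) :
    HasDerivAt (fun t : ℝ => f (x + t • v)) (f' v) 0 := by
  have h1 : HasDerivAt (fun t : ℝ => x + t • v) v 0 := by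
    simpa using ((hasDerivAt_id (0 : ℝ)).smul_const v).const_add x
  have h2 : HasFDerivAt f f' (x + (0 : ℝ) • v) := by simpa using h
  exact h2.comp_hasDerivAt (0 : ℝ) h1

/-- Along this line σ_k and σ_l are affine, so the derivative is (τ_k σ_l - σ_k τ_l)/σ_l². -/
theorem IsGamma.fderiv_vecMulVec {k l : ℕ} (hlk : l < k) (hkn : k ≤ n)
    {N : Matrix (Fin n) (Fin n) ℝ} (hN : N.IsSymm) (hG : IsGamma k N) (b : Fin n → ℝ) :
    0 ≤ fderiv ℝ (sigmaQuotient k l) N (vecMulVec b b) ∧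
      (b ≠ 0 → 0 < fderiv ℝ (sigmaQuotient k l) N (vecMulVec b b)) := by
  obtain ⟨τ, h1, -, h3, h4⟩ := sigma_add_smul_vecMulVec hlk hkn hN hG b
  have hl := hG.sigma_pos hlk.le
  have hd := hasDerivAt_comp_line (hG.hasFDerivAt_sigmaQuotient hlk hkn) (vecMulVec b b)
  have hlin : ∀ m, HasDerivAt (fun t : ℝ => sigma m N + t * τ m) (τ m) 0 := by
    intro m
    simpa using ((hasDerivAt_id (0 : ℝ)).mul_const (τ m)).const_add (sigma m N)
  have hd2 := (hlin k).div (hlin l) (by simpa using hl.ne')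
  have he : (fun t : ℝ => sigmaQuotient k l (N + t • vecMulVec b b)) =
      (fun t : ℝ => sigma k N + t * τ k) / (fun t : ℝ => sigma l N + t * τ l) := by
    ext t
    rw [sigmaQuotient, h1 k le_rfl, h1 l hlk.le]; rfl
  rw [he] at hd
  have hval : fderiv ℝ (sigmaQuotient k l) N (vecMulVec b b) = _ := hd.unique hd2
  simp only [zero_mul, add_zero] at hval
  rw [hval]
  constructor
  · exact div_nonneg (by linarith) (sq_nonneg _)
  · intro hb
    exact div_pos (by linarith [h4 hb]) (by positivity)

theorem IsGamma.fderiv_nonneg {k l : ℕ} (hlk : l < k) (hkn : k ≤ n)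
    {N S : Matrix (Fin n) (Fin n) ℝ} (hN : N.IsSymm) (hG : IsGamma k N) (hS : S.PosSemidef) :
    0 ≤ fderiv ℝ (sigmaQuotient k l) N S ∧
      (S ≠ 0 → 0 < fderiv ℝ (sigmaQuotient k l) N S) := by
  obtain ⟨m, v, rfl⟩ := posSemidef_iff_eq_sum_vecMulVec.1 hS
  simp only [star_trivial, map_sum]
  refine ⟨Finset.sum_nonneg fun i _ => (hG.fderiv_vecMulVec hlk hkn hN (v i)).1, fun hne => ?_⟩
  obtain ⟨i, -, hi⟩ := Finset.exists_ne_zero_of_sum_ne_zero hne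
  refine Finset.sum_pos' (fun i _ => (hG.fderiv_vecMulVec hlk hkn hN (v i)).1)
    ⟨i, Finset.mem_univ i, (hG.fderiv_vecMulVec hlk hkn hN (v i)).2 ?_⟩
  rintro h0
  exact hi (by simp [h0])

theorem sigmaQuotient_smul {k l : ℕ} (hlk : l < k) (hkn : k ≤ n) {t : ℝ} (ht : t ≠ 0)
    (N : Matrix (Fin n) (Fin n) ℝ) :
    sigmaQuotient k l (t • N) = t ^ (k - l) * sigmaQuotient k l N := by
  rw [sigmaQuotient, sigmaQuotient, sigma_smul hkn, sigma_smul (by omega)]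
  obtain ⟨j, rfl⟩ := Nat.exists_eq_add_of_lt hlk
  rw [show l + j + 1 - l = j + 1 by omega, show l + j + 1 = l + (j + 1) by ring, pow_add]
  field_simp

/-- Euler's relation for a function homogeneous of degree k - l. -/
theorem IsGamma.fderiv_self {k l : ℕ} (hlk : l < k) (hkn : k ≤ n)
    {N : Matrix (Fin n) (Fin n) ℝ} (hG : IsGamma k N) :
    fderiv ℝ (sigmaQuotient k l) N N = ((k - l : ℕ) : ℝ) * sigmaQuotient k l N := by
  have hd := hasDerivAt_comp_line (hG.hasFDerivAt_sigmaQuotient hlk hkn) N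
  have h1 : HasDerivAt (fun t : ℝ => (1 + t) ^ (k - l) * sigmaQuotient k l N)
      (((k - l : ℕ) : ℝ) * sigmaQuotient k l N) 0 := by
    have := (((hasDerivAt_id (0 : ℝ)).const_add 1).pow (k - l)).mul_const (sigmaQuotient k l N)
    simpa using this
  refine hd.unique (h1.congr_of_eventuallyEq ?_)
  have : ∀ᶠ t : ℝ in nhds 0, 1 + t ≠ 0 := by
    have hc : ContinuousAt (fun t : ℝ => 1 + t) 0 := by fun_prop
    exact hc.eventually_ne (by simp)
  filter_upwards [this] with t ht
  rw [← sigmaQuotient_smul hlk hkn ht, add_smul, one_smul]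

/-- The matrix with eigenvalues `∑_{j ≠ i} κ_j`, where `κ` are the eigenvalues of `W`. -/
noncomputable def complementaryMatrix :
    Matrix (Fin n) (Fin n) ℝ →ₗ[ℝ] Matrix (Fin n) (Fin n) ℝ where
  toFun W := W.trace • (1 : Matrix (Fin n) (Fin n) ℝ) - W
  map_add' := by intro A B; simp only [trace_add, add_smul]; abel
  map_smul' := by intro c A; simp only [trace_smul, smul_sub, smul_assoc, RingHom.id_apply]

theorem complementaryMatrix_apply (W : Matrix (Fin n) (Fin n) ℝ) :
    complementaryMatrix W = W.trace • (1 : Matrix (Fin n) (Fin n) ℝ) - W := rfl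

theorem isSymm_complementaryMatrix {W : Matrix (Fin n) (Fin n) ℝ} (hW : W.IsSymm) :
    (complementaryMatrix W).IsSymm :=
  (isSymm_one.smul _).sub hW

theorem posSemidef_of_forall {S : Matrix (Fin n) (Fin n) ℝ} (hS : S.IsSymm)
    (h : ∀ x : Fin n → ℝ, 0 ≤ x ⬝ᵥ S *ᵥ x) : S.PosSemidef :=
  PosSemidef.of_dotProduct_mulVec_nonneg (isHermitian_iff_isSymm.2 hS) (by simpa using h)

/-- On a rank one matrix v⊗v the claim is the Cauchy–Schwarz inequality (v·x)² ≤ |v|²|x|². -/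
theorem posSemidef_complementaryMatrix {S : Matrix (Fin n) (Fin n) ℝ} (hS : S.PosSemidef) :
    (complementaryMatrix S).PosSemidef := by
  obtain ⟨m, v, rfl⟩ := posSemidef_iff_eq_sum_vecMulVec.1 hS
  rw [map_sum]
  refine posSemidef_sum _ fun i _ => ?_
  simp only [star_trivial]
  refine posSemidef_of_forall (isSymm_complementaryMatrix (transpose_vecMulVec _ _)) fun x => ?_
  rw [complementaryMatrix_apply, trace_vecMulVec, sub_mulVec, dotProduct_sub, smul_mulVec,
    one_mulVec, vecMulVec_mulVec, dotProduct_smul]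
  have := Finset.sum_mul_sq_le_sq_mul_sq Finset.univ (v i) x
  simp only [dotProduct, op_smul_eq_smul, Pi.smul_apply, smul_eq_mul] at this ⊢
  have e1 : ∑ j, x j * ((∑ j, v i j * x j) * v i j) = (∑ j, v i j * x j) ^ 2 := by
    rw [sq, Finset.mul_sum]
    exact Finset.sum_congr rfl fun j _ => by ring
  rw [e1]
  simp only [← sq]
  linarith

/-- The trace is multiplied by n - 1, so the kernel would consist of trace-free S, on which the map
is -S. -/
theorem complementaryMatrix_ne_zero (hn : 2 ≤ n) {S : Matrix (Fin n) (Fin n) ℝ} (hS : S ≠ 0) :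
    complementaryMatrix S ≠ 0 := by
  intro h
  rw [complementaryMatrix_apply, sub_eq_zero] at h
  have ht := congrArg Matrix.trace h
  rw [trace_smul, trace_one, Fintype.card_fin, smul_eq_mul] at ht
  have hn' : (2 : ℝ) ≤ n := by exact_mod_cast hn
  have h0 : S.trace = 0 := by
    have : S.trace * ((n : ℝ) - 1) = 0 := by linarith
    rcases mul_eq_zero.1 this with h | h
    · exact h
    · linarith
  rw [h0, zero_smul] at h
  exact hS h.symm

end QuotientOperator

/-! ### The curvature operator as a function of gradient and Hessian. -/

section CurvatureOperator

open Matrix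
open scoped Matrix.Norms.Operator

variable {n : ℕ}

/-- The Lorentz factor `1 / √(1 - |p|²)`. -/
noncomputable def lorentzFactor (p : Fin n → ℝ) : ℝ := 1 / √(1 - p ⬝ᵥ p)

theorem lorentzFactor_pos {p : Fin n → ℝ} (hp : p ⬝ᵥ p < 1) : 0 < lorentzFactor p :=
  one_div_pos.2 (Real.sqrt_pos.2 (by linarith))

theorem lorentzFactor_sq_mul {p : Fin n → ℝ} (hp : p ⬝ᵥ p < 1) :
    lorentzFactor p ^ 2 * (1 - p ⬝ᵥ p) = 1 := by
  rw [lorentzFactor, div_pow, Real.sq_sqrt (by linarith)]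
  field_simp [show 1 - p ⬝ᵥ p ≠ 0 by linarith]

/-- The symmetric square root of the inverse of the induced metric `δ_{ij} - p_i p_j`. -/
noncomputable def sqrtInvMetric (p : Fin n → ℝ) : Matrix (Fin n) (Fin n) ℝ :=
  1 + (lorentzFactor p ^ 2 / (lorentzFactor p + 1)) • vecMulVec p p

theorem isSymm_vecMulVec_self (p : Fin n → ℝ) : (vecMulVec p p).IsSymm := transpose_vecMulVec p p

theorem isSymm_sqrtInvMetric (p : Fin n → ℝ) : (sqrtInvMetric p).IsSymm :=
  isSymm_one.add ((isSymm_vecMulVec_self p).smul _)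

/-- This quadratic equation for β says that (1 + β p⊗p)² = 1 + w² p⊗p, the inverse metric. The root
β = w²/(w+1) involves no division by |p|, so it is smooth at p = 0. -/
theorem sqrtInvMetric_coeff {p : Fin n → ℝ} (hp : p ⬝ᵥ p < 1) :
    2 * (lorentzFactor p ^ 2 / (lorentzFactor p + 1)) +
      (lorentzFactor p ^ 2 / (lorentzFactor p + 1)) ^ 2 * (p ⬝ᵥ p) = lorentzFactor p ^ 2 := by
  have h1 := lorentzFactor_pos hp
  have h2 := lorentzFactor_sq_mul hp
  have h3 : lorentzFactor p ^ 2 * (p ⬝ᵥ p) = lorentzFactor p ^ 2 - 1 := by linarith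
  field_simp
  linear_combination h3

theorem vecMulVec_self_mul_self (p : Fin n → ℝ) :
    vecMulVec p p * vecMulVec p p = (p ⬝ᵥ p) • vecMulVec p p := by
  rw [vecMulVec_mul_vecMulVec, vecMulVec_smul]

theorem sqrtInvMetric_mul_self {p : Fin n → ℝ} (hp : p ⬝ᵥ p < 1) :
    sqrtInvMetric p * sqrtInvMetric p = 1 + lorentzFactor p ^ 2 • vecMulVec p p := by
  conv_rhs => rw [← sqrtInvMetric_coeff hp]
  rw [sqrtInvMetric]
  set β := lorentzFactor p ^ 2 / (lorentzFactor p + 1)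
  simp only [mul_add, add_mul, one_mul, mul_one, Matrix.smul_mul, Matrix.mul_smul,
    vecMulVec_self_mul_self]
  module

theorem metric_mul_sqrtInvMetric_sq {p : Fin n → ℝ} (hp : p ⬝ᵥ p < 1) :
    (1 - vecMulVec p p) * (sqrtInvMetric p * sqrtInvMetric p) = 1 := by
  rw [sqrtInvMetric_mul_self hp]
  simp only [mul_add, sub_mul, one_mul, mul_one, Matrix.mul_smul, vecMulVec_self_mul_self]
  have h : lorentzFactor p ^ 2 - 1 - lorentzFactor p ^ 2 * (p ⬝ᵥ p) = 0 := by
    linarith [lorentzFactor_sq_mul hp]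
  have : (1 : Matrix (Fin n) (Fin n) ℝ) - vecMulVec p p + (lorentzFactor p ^ 2 • vecMulVec p p -
      lorentzFactor p ^ 2 • (p ⬝ᵥ p) • vecMulVec p p) =
      1 + (lorentzFactor p ^ 2 - 1 - lorentzFactor p ^ 2 * (p ⬝ᵥ p)) • vecMulVec p p := by
    module
  rw [this, h, zero_smul, add_zero]

theorem sqrtInvMetric_sq_mul_metric {p : Fin n → ℝ} (hp : p ⬝ᵥ p < 1) :
    (sqrtInvMetric p * sqrtInvMetric p) * (1 - vecMulVec p p) = 1 :=
  mul_eq_one_comm.1 (metric_mul_sqrtInvMetric_sq hp)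

/-- The symmetric matrix `g^{-1/2} h g^{-1/2}` of the second fundamental form, for the gradient `p`
and the Hessian `A`. -/
noncomputable def shapeMatrix (p : Fin n → ℝ) :
    Matrix (Fin n) (Fin n) ℝ →ₗ[ℝ] Matrix (Fin n) (Fin n) ℝ where
  toFun A := lorentzFactor p • (sqrtInvMetric p * A * sqrtInvMetric p)
  map_add' := by intro A B; simp only [mul_add, add_mul, smul_add]
  map_smul' := by
    intro c A
    simp only [Matrix.mul_smul, Matrix.smul_mul, RingHom.id_apply]
    rw [smul_comm]

theorem shapeMatrix_apply (p : Fin n → ℝ) (A : Matrix (Fin n) (Fin n) ℝ) :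
    shapeMatrix p A = lorentzFactor p • (sqrtInvMetric p * A * sqrtInvMetric p) := rfl

theorem isSymm_shapeMatrix (p : Fin n → ℝ) {A : Matrix (Fin n) (Fin n) ℝ} (hA : A.IsSymm) :
    (shapeMatrix p A).IsSymm := by
  rw [shapeMatrix_apply]
  refine IsSymm.smul ?_ _
  rw [IsSymm, transpose_mul, transpose_mul, hA, isSymm_sqrtInvMetric, mul_assoc]

theorem posSemidef_shapeMatrix {p : Fin n → ℝ} (hp : p ⬝ᵥ p < 1) {S : Matrix (Fin n) (Fin n) ℝ}
    (hS : S.PosSemidef) : (shapeMatrix p S).PosSemidef := by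
  rw [shapeMatrix_apply]
  refine PosSemidef.smul ?_ (lorentzFactor_pos hp).le
  have := hS.mul_mul_conjTranspose_same (sqrtInvMetric p)
  rwa [conjTranspose_eq_transpose_of_trivial, isSymm_sqrtInvMetric] at this

/-- The congruence by g^{-1/2} is invertible: multiplying by g g^{-1/2} and g^{-1/2} g recovers S.
-/
theorem shapeMatrix_ne_zero {p : Fin n → ℝ} (hp : p ⬝ᵥ p < 1) {S : Matrix (Fin n) (Fin n) ℝ}
    (hS : S ≠ 0) : shapeMatrix p S ≠ 0 := by
  intro h
  rw [shapeMatrix_apply, smul_eq_zero_iff_right (lorentzFactor_pos hp).ne'] at h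
  apply hS
  calc S = ((1 - vecMulVec p p) * (sqrtInvMetric p * sqrtInvMetric p)) * S *
        ((sqrtInvMetric p * sqrtInvMetric p) * (1 - vecMulVec p p)) := by
        rw [metric_mul_sqrtInvMetric_sq hp, sqrtInvMetric_sq_mul_metric hp, one_mul, mul_one]
    _ = (1 - vecMulVec p p) * sqrtInvMetric p * (sqrtInvMetric p * S * sqrtInvMetric p) *
        (sqrtInvMetric p * (1 - vecMulVec p p)) := by simp only [mul_assoc]
    _ = 0 := by rw [h]; simp

/-- The curvature operator `(σ_k / σ_l)(λ(η))` as a function of the gradient and the Hessian. -/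
noncomputable def curvatureOperator (k l : ℕ)
    (z : (Fin n → ℝ) × Matrix (Fin n) (Fin n) ℝ) : ℝ :=
  sigmaQuotient k l (complementaryMatrix (shapeMatrix z.1 z.2))

/-- Admissibility of a pair (gradient, Hessian). -/
structure AdmissiblePair (k : ℕ) (p : Fin n → ℝ) (A : Matrix (Fin n) (Fin n) ℝ) : Prop where
  lt_one : p ⬝ᵥ p < 1
  symm : A.IsSymm
  gamma : IsGamma k (complementaryMatrix (shapeMatrix p A))

theorem contDiffAt_apply_fst (i : Fin n) (z : (Fin n → ℝ) × Matrix (Fin n) (Fin n) ℝ) :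
    ContDiffAt ℝ 1 (fun y : (Fin n → ℝ) × Matrix (Fin n) (Fin n) ℝ => y.1 i) z :=
  (contDiffAt_pi.1 (contDiffAt_fst (𝕜 := ℝ) (n := 1) (p := z))) i

theorem contDiffAt_shapeMatrix {z : (Fin n → ℝ) × Matrix (Fin n) (Fin n) ℝ}
    (hz : z.1 ⬝ᵥ z.1 < 1) : ContDiffAt ℝ 1
      (fun y : (Fin n → ℝ) × Matrix (Fin n) (Fin n) ℝ =>
        complementaryMatrix (shapeMatrix y.1 y.2)) z := by
  have hfst := fun i => contDiffAt_apply_fst i z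
  have hdot : ContDiffAt ℝ 1
      (fun y : (Fin n → ℝ) × Matrix (Fin n) (Fin n) ℝ => y.1 ⬝ᵥ y.1) z := by
    simp only [dotProduct]
    exact ContDiffAt.sum fun i _ => (hfst i).mul (hfst i)
  have hw : ContDiffAt ℝ 1
      (fun y : (Fin n → ℝ) × Matrix (Fin n) (Fin n) ℝ => lorentzFactor y.1) z := by
    refine contDiffAt_const.div ((contDiffAt_const.sub hdot).sqrt ?_) ?_
    · linarith
    · exact (Real.sqrt_pos.2 (by linarith)).ne'
  have hR : ContDiffAt ℝ 1
      (fun y : (Fin n → ℝ) × Matrix (Fin n) (Fin n) ℝ => sqrtInvMetric y.1) z := by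
    have hβ := (hw.pow 2).div (hw.add contDiffAt_const)
      (by linarith [lorentzFactor_pos hz] : lorentzFactor z.1 + 1 > 0).ne'
    have hv : ContDiffAt ℝ 1
        (fun y : (Fin n → ℝ) × Matrix (Fin n) (Fin n) ℝ => vecMulVec y.1 y.1) z :=
      contDiffAt_matrix fun i j => (hfst i).mul (hfst j)
    exact contDiffAt_const.add (hβ.smul hv)
  have hS : ContDiffAt ℝ 1
      (fun y : (Fin n → ℝ) × Matrix (Fin n) (Fin n) ℝ => shapeMatrix y.1 y.2) z :=
    hw.smul ((hR.mul contDiffAt_snd).mul hR)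
  exact (LinearMap.toContinuousLinearMap complementaryMatrix).contDiff.contDiffAt.comp z hS

theorem AdmissiblePair.contDiffAt {k l : ℕ} (hlk : l < k) (hkn : k ≤ n) {p : Fin n → ℝ}
    {A : Matrix (Fin n) (Fin n) ℝ} (h : AdmissiblePair k p A) :
    ContDiffAt ℝ 1 (curvatureOperator k l) (p, A) :=
  (h.gamma.contDiffAt_sigmaQuotient hlk hkn).comp (p, A) (contDiffAt_shapeMatrix h.lt_one)

theorem AdmissiblePair.hasFDerivAt {k l : ℕ} (hlk : l < k) (hkn : k ≤ n) {p : Fin n → ℝ}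
    {A : Matrix (Fin n) (Fin n) ℝ} (h : AdmissiblePair k p A) :
    HasFDerivAt (curvatureOperator k l) (fderiv ℝ (curvatureOperator k l) (p, A)) (p, A) :=
  ((h.contDiffAt hlk hkn).differentiableAt one_ne_zero).hasFDerivAt

/-- Admissibility is an open condition. -/
theorem AdmissiblePair.eventually {k : ℕ} (hkn : k ≤ n) {p : Fin n → ℝ}
    {A : Matrix (Fin n) (Fin n) ℝ} (h : AdmissiblePair k p A) :
    ∀ᶠ z : (Fin n → ℝ) × Matrix (Fin n) (Fin n) ℝ in nhds (p, A),
      z.2.IsSymm → AdmissiblePair k z.1 z.2 := by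
  have h1 : ∀ᶠ z : (Fin n → ℝ) × Matrix (Fin n) (Fin n) ℝ in nhds (p, A), z.1 ⬝ᵥ z.1 < 1 := by
    have : Continuous fun z : (Fin n → ℝ) × Matrix (Fin n) (Fin n) ℝ => z.1 ⬝ᵥ z.1 := by
      fun_prop
    exact this.continuousAt.eventually (gt_mem_nhds h.lt_one)
  have h2 : ∀ᶠ z : (Fin n → ℝ) × Matrix (Fin n) (Fin n) ℝ in nhds (p, A),
      ∀ m ∈ Finset.Icc 1 k, 0 < sigma m (complementaryMatrix (shapeMatrix z.1 z.2)) := by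
    rw [Filter.eventually_all_finset]
    intro m hm
    rw [Finset.mem_Icc] at hm
    have hc : ContinuousAt (fun z : (Fin n → ℝ) × Matrix (Fin n) (Fin n) ℝ =>
        sigma m (complementaryMatrix (shapeMatrix z.1 z.2))) (p, A) :=
      ((contDiff_sigma (by omega)).contDiffAt.comp (p, A)
        (contDiffAt_shapeMatrix (z := (p, A)) h.lt_one)).continuousAt
    exact hc.eventually (lt_mem_nhds (h.gamma m hm.1 hm.2))
  filter_upwards [h1, h2] with z hz1 hz2 hs
  exact ⟨hz1, hs, fun m hm1 hm2 => hz2 m (Finset.mem_Icc.2 ⟨hm1, hm2⟩)⟩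

/-- For fixed gradient, η is linear in the Hessian, so positivity and Euler's relation pass from the
quotient to the operator. -/
theorem AdmissiblePair.fderiv_hessian {k l : ℕ} (hlk : l < k) (hkn : k ≤ n) {p : Fin n → ℝ}
    {A : Matrix (Fin n) (Fin n) ℝ} (h : AdmissiblePair k p A) (S : Matrix (Fin n) (Fin n) ℝ) :
    fderiv ℝ (curvatureOperator k l) (p, A) (0, S) =
      fderiv ℝ (sigmaQuotient k l) (complementaryMatrix (shapeMatrix p A))
        (complementaryMatrix (shapeMatrix p S)) := by
  have h1 := hasDerivAt_comp_line (h.hasFDerivAt hlk hkn) (0, S)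
  have h2 := hasDerivAt_comp_line (h.gamma.hasFDerivAt_sigmaQuotient hlk hkn)
    (complementaryMatrix (shapeMatrix p S))
  refine h1.unique (h2.congr_of_eventuallyEq (Filter.Eventually.of_forall fun t => ?_))
  simp [curvatureOperator]

theorem AdmissiblePair.fderiv_nonneg {k l : ℕ} (hlk : l < k) (hkn : k ≤ n) {p : Fin n → ℝ}
    {A : Matrix (Fin n) (Fin n) ℝ} (h : AdmissiblePair k p A) {S : Matrix (Fin n) (Fin n) ℝ}
    (hS : S.PosSemidef) : 0 ≤ fderiv ℝ (curvatureOperator k l) (p, A) (0, S) := by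
  rw [h.fderiv_hessian hlk hkn]
  exact (h.gamma.fderiv_nonneg hlk hkn
    (isSymm_complementaryMatrix (isSymm_shapeMatrix p h.symm))
    (posSemidef_complementaryMatrix (posSemidef_shapeMatrix h.lt_one hS))).1

theorem AdmissiblePair.fderiv_pos {k l : ℕ} (hlk : l < k) (hkn : k ≤ n) (hn : 2 ≤ n)
    {p : Fin n → ℝ} {A : Matrix (Fin n) (Fin n) ℝ} (h : AdmissiblePair k p A)
    {S : Matrix (Fin n) (Fin n) ℝ} (hS : S.PosSemidef) (hS0 : S ≠ 0) :
    0 < fderiv ℝ (curvatureOperator k l) (p, A) (0, S) := by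
  rw [h.fderiv_hessian hlk hkn]
  exact (h.gamma.fderiv_nonneg hlk hkn
    (isSymm_complementaryMatrix (isSymm_shapeMatrix p h.symm))
    (posSemidef_complementaryMatrix (posSemidef_shapeMatrix h.lt_one hS))).2
    (complementaryMatrix_ne_zero hn (shapeMatrix_ne_zero h.lt_one hS0))

theorem AdmissiblePair.fderiv_self {k l : ℕ} (hlk : l < k) (hkn : k ≤ n) {p : Fin n → ℝ}
    {A : Matrix (Fin n) (Fin n) ℝ} (h : AdmissiblePair k p A) :
    fderiv ℝ (curvatureOperator k l) (p, A) (0, A) =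
      ((k - l : ℕ) : ℝ) * curvatureOperator k l (p, A) := by
  rw [h.fderiv_hessian hlk hkn, h.gamma.fderiv_self hlk hkn]
  rfl

theorem AdmissiblePair.le_add {k l : ℕ} (hlk : l < k) (hkn : k ≤ n) {p : Fin n → ℝ}
    {A : Matrix (Fin n) (Fin n) ℝ} (h : AdmissiblePair k p A) {S : Matrix (Fin n) (Fin n) ℝ}
    (hS : S.PosSemidef) : curvatureOperator k l (p, A) ≤ curvatureOperator k l (p, A + S) := by
  have := (h.gamma.add_posSemidef hlk hkn
    (isSymm_complementaryMatrix (isSymm_shapeMatrix p h.symm))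
    (posSemidef_complementaryMatrix (posSemidef_shapeMatrix h.lt_one hS))).2
  simpa only [curvatureOperator, map_add] using this

/-- The shape matrix along the ray through a gradient which is an eigenvector of the Hessian. -/
theorem shapeMatrix_smul_of_eigenvector {p : Fin n → ℝ} {A : Matrix (Fin n) (Fin n) ℝ}
    (hA : A.IsSymm) {b : ℝ} (hAp : A *ᵥ p = (-b) • p) {c : ℝ} (hc : (c • p) ⬝ᵥ (c • p) < 1) :
    shapeMatrix (c • p) A = lorentzFactor (c • p) • A -
      (b * (lorentzFactor (c • p) ^ 3 * c ^ 2)) • vecMulVec p p := by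
  have h1 : A * vecMulVec p p = (-b) • vecMulVec p p := by
    rw [mul_vecMulVec, hAp, smul_vecMulVec]
  have h2 : vecMulVec p p * A = (-b) • vecMulVec p p := by
    rw [vecMulVec_mul, ← mulVec_transpose, hA, hAp, vecMulVec_smul]
  have h3 := sqrtInvMetric_coeff hc
  rw [shapeMatrix_apply, sqrtInvMetric]
  set w := lorentzFactor (c • p)
  set β := w ^ 2 / (w + 1)
  have h4 : 2 * β + β ^ 2 * (c ^ 2 * (p ⬝ᵥ p)) = w ^ 2 := by
    rw [← h3]; simp only [smul_dotProduct, dotProduct_smul, smul_eq_mul]; ring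
  have h5 : b * (w ^ 3 * c ^ 2) =
      w * b * c ^ 2 * (2 * β + β ^ 2 * (c ^ 2 * (p ⬝ᵥ p))) := by rw [h4]; ring
  rw [h5]
  simp only [smul_vecMulVec, vecMulVec_smul, mul_add, add_mul, one_mul, mul_one, Matrix.smul_mul,
    Matrix.mul_smul, h1, h2, vecMulVec_self_mul_self]
  module

theorem hasDerivAt_lorentzFactor_ray {p : Fin n → ℝ} (hp : p ⬝ᵥ p < 1) :
    HasDerivAt (fun t : ℝ => lorentzFactor ((1 + t) • p))
      (lorentzFactor p ^ 3 * (p ⬝ᵥ p)) 0 := by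
  have hw := lorentzFactor_pos hp
  have h1 : HasDerivAt (fun t : ℝ => 1 - (1 + t) ^ 2 * (p ⬝ᵥ p)) (-(2 * (p ⬝ᵥ p))) 0 := by
    have := ((((hasDerivAt_id (0 : ℝ)).const_add 1).pow 2).mul_const (p ⬝ᵥ p)).const_sub 1
    simpa using this
  have hs : 0 < √(1 - p ⬝ᵥ p) := Real.sqrt_pos.2 (by linarith)
  have h2 := (h1.sqrt (by simp; linarith)).inv (by simpa using hs.ne')
  have e : (fun t : ℝ => lorentzFactor ((1 + t) • p)) =
      (fun t : ℝ => √(1 - (1 + t) ^ 2 * (p ⬝ᵥ p)))⁻¹ := by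
    ext t
    simp only [lorentzFactor, one_div, Pi.inv_apply, smul_dotProduct, dotProduct_smul, smul_eq_mul]
    congr 3; ring
  rw [e]
  convert! h2 using 1
  simp only [lorentzFactor, add_zero, one_pow, one_mul]
  field_simp

/-- When p is an eigenvector of A, the shape matrix along the ray (1+t)p is explicit, and its
derivative at t = 0 is a combination of the shape matrices of A and of p⊗p. The gradient derivative
thus reduces to Hessian derivatives, the first of which is given by Euler's relation. -/
theorem AdmissiblePair.fderiv_gradient {k l : ℕ} (hlk : l < k) (hkn : k ≤ n) {p : Fin n → ℝ}
    {A : Matrix (Fin n) (Fin n) ℝ} (h : AdmissiblePair k p A) {b : ℝ}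
    (hAp : A *ᵥ p = (-b) • p) :
    fderiv ℝ (curvatureOperator k l) (p, A) (p, 0) =
      lorentzFactor p ^ 2 * (p ⬝ᵥ p) * (((k - l : ℕ) : ℝ) * curvatureOperator k l (p, A)) -
        2 * lorentzFactor p ^ 2 * b *
          fderiv ℝ (curvatureOperator k l) (p, A) (0, vecMulVec p p) := by
  have hp := h.lt_one
  set w := lorentzFactor p with hw
  have hw2 : w ^ 2 * (1 - p ⬝ᵥ p) = 1 := lorentzFactor_sq_mul hp
  have hA1 : shapeMatrix p A = w • A - (b * w ^ 3) • vecMulVec p p := by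
    have := shapeMatrix_smul_of_eigenvector h.symm hAp (c := 1) (by simpa using hp)
    simpa using this
  have hpp : shapeMatrix p (vecMulVec p p) = w ^ 3 • vecMulVec p p := by
    have := shapeMatrix_smul_of_eigenvector (isSymm_vecMulVec_self p) (b := -(p ⬝ᵥ p)) (p := p)
      (by rw [vecMulVec_mulVec, neg_neg]; simp) (c := 1) (by simpa using hp)
    simp only [one_smul, one_pow, mul_one] at this
    rw [this, ← sub_smul, ← hw]
    congr 1
    linear_combination (-w) * hw2
  have h1 := hasDerivAt_comp_line (h.hasFDerivAt hlk hkn) (p, 0)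
  have hwd := hasDerivAt_lorentzFactor_ray hp
  have hcd : HasDerivAt (fun t : ℝ => b * (lorentzFactor ((1 + t) • p) ^ 3 * (1 + t) ^ 2))
      (b * (3 * w ^ 2 * (w ^ 3 * (p ⬝ᵥ p)) + w ^ 3 * 2)) 0 := by
    have := ((hwd.pow 3).mul (((hasDerivAt_id (0 : ℝ)).const_add 1).pow 2)).const_mul b
    simpa using this
  have hMd := (hwd.smul_const A).sub (hcd.smul_const (vecMulVec p p))
  set M' := (w ^ 3 * (p ⬝ᵥ p)) • A -
    (b * (3 * w ^ 2 * (w ^ 3 * (p ⬝ᵥ p)) + w ^ 3 * 2)) • vecMulVec p p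
  have hCd := (LinearMap.toContinuousLinearMap
    (complementaryMatrix (n := n))).hasFDerivAt.comp_hasDerivAt (0 : ℝ) hMd
  have hΦ : HasFDerivAt (sigmaQuotient k l)
      (fderiv ℝ (sigmaQuotient k l) (complementaryMatrix (shapeMatrix p A)))
      (complementaryMatrix (lorentzFactor ((1 + (0 : ℝ)) • p) • A -
        (b * (lorentzFactor ((1 + (0 : ℝ)) • p) ^ 3 * (1 + (0 : ℝ)) ^ 2)) • vecMulVec p p)) := by
    have := h.gamma.hasFDerivAt_sigmaQuotient hlk hkn
    simpa [hA1, hw] using this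
  have h2 := hΦ.comp_hasDerivAt (0 : ℝ) hCd
  have hev : ∀ᶠ t : ℝ in nhds 0, ((1 + t) • p) ⬝ᵥ ((1 + t) • p) < 1 := by
    have hc : Continuous fun t : ℝ => ((1 + t) • p) ⬝ᵥ ((1 + t) • p) := by fun_prop
    exact hc.continuousAt.eventually (gt_mem_nhds (by simpa using hp))
  have hval : fderiv ℝ (curvatureOperator k l) (p, A) (p, 0) =
      fderiv ℝ (sigmaQuotient k l) (complementaryMatrix (shapeMatrix p A))
        (complementaryMatrix M') := by
    refine h1.unique (h2.congr_of_eventuallyEq ?_)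
    filter_upwards [hev] with t ht
    have e : (p, A) + t • ((p, 0) : (Fin n → ℝ) × Matrix (Fin n) (Fin n) ℝ) =
        ((1 + t) • p, A) := by simp [add_smul]
    rw [e, curvatureOperator]
    simp only
    rw [shapeMatrix_smul_of_eigenvector h.symm hAp ht]
    rfl
  -- The p⊗p coefficients match because w²(1 - |p|²) = 1, that is, w²|p|² + 1 = w².
  have hM' : M' = (w ^ 2 * (p ⬝ᵥ p)) • shapeMatrix p A -
      (2 * w ^ 2 * b) • shapeMatrix p (vecMulVec p p) := by
    rw [hA1, hpp]
    have e : b * (3 * w ^ 2 * (w ^ 3 * (p ⬝ᵥ p)) + w ^ 3 * 2) =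
        w ^ 2 * (p ⬝ᵥ p) * (b * w ^ 3) + 2 * w ^ 2 * b * w ^ 3 := by
      linear_combination (-2 * b * w ^ 3) * hw2
    simp only [M']
    rw [e]
    module
  rw [hval, hM', map_sub, map_smul, map_smul, map_sub, map_smul, map_smul,
    ← h.fderiv_hessian hlk hkn, ← h.fderiv_hessian hlk hkn, h.fderiv_self hlk hkn]
  simp only [smul_eq_mul]

/-- The linearized operator at a critical point of `log w + B u`: here `-B (1 - |p|²) p` is the
derivative of the gradient and `T` that of the Hessian in the direction `p`. -/
theorem AdmissiblePair.fderiv_le {k l : ℕ} (hlk : l < k) (hkn : k ≤ n) {p : Fin n → ℝ}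
    {A : Matrix (Fin n) (Fin n) ℝ} (h : AdmissiblePair k p A) {B : ℝ}
    (hAp : A *ᵥ p = (-(B * (1 - p ⬝ᵥ p))) • p) {T : Matrix (Fin n) (Fin n) ℝ}
    (hT : (-(T + A * A + (1 - p ⬝ᵥ p) • ((2 * B ^ 2) • vecMulVec p p + B • A))).PosSemidef) :
    fderiv ℝ (curvatureOperator k l) (p, A) ((-(B * (1 - p ⬝ᵥ p))) • p, T) ≤
      -(B * (((k - l : ℕ) : ℝ) * curvatureOperator k l (p, A))) := by
  set q := 1 - p ⬝ᵥ p with hq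
  have hw2 : lorentzFactor p ^ 2 * q = 1 := lorentzFactor_sq_mul h.lt_one
  set w := lorentzFactor p
  set L := fderiv ℝ (curvatureOperator k l) (p, A)
  have h1 := h.fderiv_nonneg hlk hkn (l := l) hT
  have hAA : (A * A).PosSemidef := by
    have := posSemidef_self_mul_conjTranspose A
    rwa [conjTranspose_eq_transpose_of_trivial, h.symm] at this
  have h2 := h.fderiv_nonneg hlk hkn (l := l) hAA
  have h3 := h.fderiv_self hlk hkn (l := l)
  have h4 := h.fderiv_gradient hlk hkn (l := l) hAp
  set D : Matrix (Fin n) (Fin n) ℝ →ₗ[ℝ] ℝ :=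
    L.toLinearMap.comp (LinearMap.inr ℝ (Fin n → ℝ) (Matrix (Fin n) (Fin n) ℝ)) with hD
  have hDe : ∀ S, L (0, S) = D S := fun S => rfl
  rw [hDe] at h1 h2 h3 h4
  have h5 : L ((-(B * q)) • p, T) = (-(B * q)) * L (p, 0) + D T := by
    have : ((-(B * q)) • p, T) =
        (-(B * q)) • ((p, 0) : (Fin n → ℝ) × Matrix (Fin n) (Fin n) ℝ) + (0, T) := by simp
    rw [this, map_add, map_smul, smul_eq_mul, hDe]
  simp only [map_neg, map_add, map_smul, smul_eq_mul] at h1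
  rw [h5, h4]
  set Q := ((k - l : ℕ) : ℝ) * curvatureOperator k l (p, A)
  rw [h3] at h1
  -- The term 2B²q D(p⊗p) from the gradient derivative cancels the one in `h1`, and -B(1-q)Q
  -- combines with -BqQ to -BQ.
  have e1 : (-(B * q)) * (w ^ 2 * (p ⬝ᵥ p) * Q - 2 * w ^ 2 * (B * q) * D (vecMulVec p p)) =
      -(B * (1 - q) * Q) + 2 * B ^ 2 * q * D (vecMulVec p p) := by
    have : p ⬝ᵥ p = 1 - q := by rw [hq]; ring
    rw [this]
    linear_combination (-(B * (1 - q) * Q) + 2 * B ^ 2 * q * D (vecMulVec p p)) * hw2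
  rw [e1]
  linarith

end CurvatureOperator

/-! ### From eigenvalues with respect to g to the symmetric shape matrix. -/

section GraphGeometry

open Matrix

variable {n : ℕ}

theorem charpoly_eq_of_conj {P Q : Matrix (Fin n) (Fin n) ℝ} (h : Q * P = 1)
    (N : Matrix (Fin n) (Fin n) ℝ) : (P * N * Q).charpoly = N.charpoly := by
  rw [charpoly_mul_comm, ← mul_assoc, h, one_mul]

theorem roots_charpoly_complementaryMatrix {W : Matrix (Fin n) (Fin n) ℝ} (hW : W.IsSymm) :
    (complementaryMatrix W).charpoly.roots = complementarySums W.charpoly.roots := by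
  have hH : W.IsHermitian := isHermitian_iff_isSymm.2 hW
  set U : Matrix (Fin n) (Fin n) ℝ := (hH.eigenvectorUnitary : Matrix (Fin n) (Fin n) ℝ)
  set d : Fin n → ℝ := hH.eigenvalues
  have hUU : Uᵀ * U = 1 := by
    have := Unitary.coe_star_mul_self hH.eigenvectorUnitary
    simpa [star_eq_conjTranspose] using this
  have hUU' : U * Uᵀ = 1 := by
    have := Unitary.coe_mul_star_self hH.eigenvectorUnitary
    simpa [star_eq_conjTranspose] using this
  have hWd : W = U * diagonal d * Uᵀ := by
    have := hH.spectral_theorem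
    rw [Unitary.conjStarAlgAut_apply] at this
    simpa [star_eq_conjTranspose] using this
  have hroots : ∀ e : Fin n → ℝ, (diagonal e).charpoly.roots = Finset.univ.val.map e := by
    intro e
    rw [charpoly_diagonal, Polynomial.roots_prod _ _
      (Finset.prod_ne_zero_iff.2 fun i _ => Polynomial.X_sub_C_ne_zero _)]
    simp only [Polynomial.roots_X_sub_C, Multiset.bind_singleton]
  have htr : W.trace = ∑ i, d i := by simpa using hH.trace_eq_sum_eigenvalues
  have hC : complementaryMatrix W = U * diagonal (fun i => W.trace - d i) * Uᵀ := by
    have : diagonal (fun i => W.trace - d i) =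
        W.trace • (1 : Matrix (Fin n) (Fin n) ℝ) - diagonal d := by
      rw [smul_one_eq_diagonal, diagonal_sub]
    rw [this, mul_sub, sub_mul, ← hWd, complementaryMatrix_apply, Matrix.mul_smul, mul_one,
      Matrix.smul_mul, hUU']
  have h1 : W.charpoly.roots = Finset.univ.val.map d := by
    rw [← hroots d, ← charpoly_eq_of_conj hUU (diagonal d), ← hWd]
  rw [hC, charpoly_eq_of_conj hUU, hroots, complementarySums, h1, Multiset.map_map, htr]
  rfl

/-- The gradient as a coordinate vector. -/
noncomputable def gradVec (u : EuclideanSpace ℝ (Fin n) → ℝ) (x : EuclideanSpace ℝ (Fin n)) :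
    Fin n → ℝ := fun i => gradient u x i

theorem gradVec_dotProduct_self (u : EuclideanSpace ℝ (Fin n) → ℝ)
    (x : EuclideanSpace ℝ (Fin n)) : gradVec u x ⬝ᵥ gradVec u x = ‖gradient u x‖ ^ 2 := by
  rw [EuclideanSpace.norm_sq_eq]
  simp [gradVec, dotProduct, sq]

theorem metric_eq (u : EuclideanSpace ℝ (Fin n) → ℝ) (x : EuclideanSpace ℝ (Fin n)) :
    metric u x = 1 - vecMulVec (gradVec u x) (gradVec u x) := by
  ext i j
  simp [metric, gradVec, vecMulVec_apply, one_apply]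

theorem secondFundamentalForm_eq (u : EuclideanSpace ℝ (Fin n) → ℝ)
    (x : EuclideanSpace ℝ (Fin n)) :
    secondFundamentalForm u x = lorentzFactor (gradVec u x) • hessian u x := by
  ext i j
  simp [secondFundamentalForm, lorentzFactor, gradVec_dotProduct_self, div_eq_inv_mul]

variable {u : EuclideanSpace ℝ (Fin n) → ℝ} {x : EuclideanSpace ℝ (Fin n)}

theorem inv_metric_eq (hp : gradVec u x ⬝ᵥ gradVec u x < 1) :
    (metric u x)⁻¹ = sqrtInvMetric (gradVec u x) * sqrtInvMetric (gradVec u x) := by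
  rw [metric_eq]
  exact inv_eq_right_inv (metric_mul_sqrtInvMetric_sq hp)

theorem shapeMatrix_eq :
    shapeMatrix (gradVec u x) (hessian u x) =
      sqrtInvMetric (gradVec u x) * secondFundamentalForm u x * sqrtInvMetric (gradVec u x) := by
  rw [shapeMatrix_apply, secondFundamentalForm_eq, Matrix.mul_smul, Matrix.smul_mul]

theorem principalCurvatures_eq (hp : gradVec u x ⬝ᵥ gradVec u x < 1) :
    principalCurvatures u x = (shapeMatrix (gradVec u x) (hessian u x)).charpoly.roots := by
  rw [principalCurvatures, eigenvaluesWrt, inv_metric_eq hp, shapeMatrix_eq, mul_assoc,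
    charpoly_mul_comm]

theorem meanCurvature_eq (hp : gradVec u x ⬝ᵥ gradVec u x < 1) :
    meanCurvature u x = (shapeMatrix (gradVec u x) (hessian u x)).trace := by
  rw [meanCurvature, inv_metric_eq hp, shapeMatrix_eq, mul_assoc, trace_mul_comm]

/-- With R = g^{-1/2}, the matrices g⁻¹η and RηR have the same characteristic polynomial, and RgR =
1 turns η = Hg - h into tr(W)·1 - W. -/
theorem eigenvaluesWrt_etaTensor (hp : gradVec u x ⬝ᵥ gradVec u x < 1) :
    eigenvaluesWrt (metric u x) (etaTensor u x) =
      (complementaryMatrix (shapeMatrix (gradVec u x) (hessian u x))).charpoly.roots := by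
  set R := sqrtInvMetric (gradVec u x)
  have hRg : R * metric u x * R = 1 := by
    rw [mul_eq_one_comm, ← mul_assoc, metric_eq]
    exact sqrtInvMetric_sq_mul_metric hp
  rw [eigenvaluesWrt, inv_metric_eq hp, mul_assoc, charpoly_mul_comm, etaTensor,
    meanCurvature_eq hp, mul_sub, sub_mul, Matrix.mul_smul, Matrix.smul_mul, hRg,
    complementaryMatrix_apply, shapeMatrix_eq]

theorem quotientCurvature_eq {k l : ℕ} (hlk : l < k) (hkn : k ≤ n)
    (hp : gradVec u x ⬝ᵥ gradVec u x < 1) (hA : (hessian u x).IsSymm) :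
    quotientCurvature k l u x = curvatureOperator k l (gradVec u x, hessian u x) := by
  have hs : (complementaryMatrix
      (shapeMatrix (gradVec u x) (hessian u x))).charpoly.Splits :=
    (isHermitian_iff_isSymm.2
      (isSymm_complementaryMatrix (isSymm_shapeMatrix _ hA))).splits_charpoly
  rw [quotientCurvature, eigenvaluesWrt_etaTensor hp, curvatureOperator, sigmaQuotient,
    sigma_eq_esymm_roots hkn hs, sigma_eq_esymm_roots (by omega) hs]

theorem admissiblePair_of_mem {k : ℕ} (hkn : k ≤ n)
    (hp : gradVec u x ⬝ᵥ gradVec u x < 1) (hA : (hessian u x).IsSymm)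
    (h : principalCurvatures u x ∈ gammaTildeCone k) :
    AdmissiblePair k (gradVec u x) (hessian u x) := by
  refine ⟨hp, hA, fun m h1 h2 => ?_⟩
  have hW := isSymm_shapeMatrix (gradVec u x) hA
  rw [sigma_eq_esymm_roots (by omega)
    (isHermitian_iff_isSymm.2 (isSymm_complementaryMatrix hW)).splits_charpoly,
    roots_charpoly_complementaryMatrix hW, ← principalCurvatures_eq hp]
  exact h m h1 h2

end GraphGeometry

/-! ### Derivatives along lines and conditions at a maximum. -/

section Derivatives

open Matrix
open scoped Matrix.Norms.Operator Topology

variable {n : ℕ} {u : EuclideanSpace ℝ (Fin n) → ℝ} {x : EuclideanSpace ℝ (Fin n)}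

theorem gradVec_apply (u : EuclideanSpace ℝ (Fin n) → ℝ) (x : EuclideanSpace ℝ (Fin n))
    (i : Fin n) : gradVec u x i = fderiv ℝ u x (EuclideanSpace.single i 1) := by
  rw [← inner_gradient_left, EuclideanSpace.inner_single_right]
  simp [gradVec]

theorem hessian_apply (u : EuclideanSpace ℝ (Fin n) → ℝ) (x : EuclideanSpace ℝ (Fin n))
    (i j : Fin n) : hessian u x i j =
      fderiv ℝ (fderiv ℝ u) x (EuclideanSpace.single i 1) (EuclideanSpace.single j 1) := rfl

theorem apply_eq_sum {F : Type*} [NormedAddCommGroup F] [NormedSpace ℝ F]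
    (f : EuclideanSpace ℝ (Fin n) →L[ℝ] F) (v : EuclideanSpace ℝ (Fin n)) :
    f v = ∑ i, v i • f (EuclideanSpace.single i 1) := by
  conv_lhs => rw [← (EuclideanSpace.basisFun (Fin n) ℝ).sum_repr v]
  simp [map_sum]

theorem fderiv_eq_dotProduct (v : EuclideanSpace ℝ (Fin n)) :
    fderiv ℝ u x v = gradVec u x ⬝ᵥ v.ofLp := by
  rw [apply_eq_sum, dotProduct]
  exact Finset.sum_congr rfl fun i _ => by rw [gradVec_apply, smul_eq_mul, mul_comm]

theorem fderiv_fderiv_eq_dotProduct (v w : EuclideanSpace ℝ (Fin n)) :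
    fderiv ℝ (fderiv ℝ u) x v w = v.ofLp ⬝ᵥ hessian u x *ᵥ w.ofLp := by
  rw [apply_eq_sum _ v, _root_.sum_apply, dotProduct]
  refine Finset.sum_congr rfl fun i _ => ?_
  rw [_root_.smul_apply, apply_eq_sum _ w, smul_eq_mul, mulVec, dotProduct]
  congr 1
  exact Finset.sum_congr rfl fun j _ => by rw [hessian_apply, smul_eq_mul, mul_comm]

theorem isSymm_hessian (hu : ContDiffAt ℝ 2 u x) : (hessian u x).IsSymm := by
  ext i j
  rw [transpose_apply, hessian_apply, hessian_apply]
  exact hu.isSymmSndFDerivAt (by simp) _ _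

theorem hasDerivAt_line {F : Type*} [NormedAddCommGroup F] [NormedSpace ℝ F]
    {f : EuclideanSpace ℝ (Fin n) → F} {v : EuclideanSpace ℝ (Fin n)} {t : ℝ}
    (hf : DifferentiableAt ℝ f (x + t • v)) :
    HasDerivAt (fun s : ℝ => f (x + s • v)) (fderiv ℝ f (x + t • v) v) t := by
  have h1 : HasDerivAt (fun s : ℝ => x + s • v) v t := by
    simpa using ((hasDerivAt_id t).smul_const v).const_add x
  exact hf.hasFDerivAt.comp_hasDerivAt t h1

theorem hasDerivAt_gradVec {v : EuclideanSpace ℝ (Fin n)} {t : ℝ}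
    (hu : ContDiffAt ℝ 2 u (x + t • v)) :
    HasDerivAt (fun s : ℝ => gradVec u (x + s • v)) (hessian u (x + t • v) *ᵥ v.ofLp) t := by
  have hd : DifferentiableAt ℝ (fderiv ℝ u) (x + t • v) :=
    (hu.fderiv_right (m := 1) le_rfl).differentiableAt one_ne_zero
  rw [hasDerivAt_pi]
  intro i
  have h1 := (hasDerivAt_line hd).clm_apply (hasDerivAt_const t (EuclideanSpace.single i (1 : ℝ)))
  simp only [map_zero, add_zero] at h1
  simp only [gradVec_apply]
  convert! h1 using 1
  rw [(hu.isSymmSndFDerivAt (by simp)) v, fderiv_fderiv_eq_dotProduct]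
  simp

/-- The derivative of the Hessian in the direction `v`. -/
noncomputable def hessianDeriv (u : EuclideanSpace ℝ (Fin n) → ℝ)
    (x v : EuclideanSpace ℝ (Fin n)) : Matrix (Fin n) (Fin n) ℝ :=
  Matrix.of fun i j => fderiv ℝ (fderiv ℝ (fderiv ℝ u)) x v
    (EuclideanSpace.single i 1) (EuclideanSpace.single j 1)

theorem differentiableAt_fderiv_fderiv (hu : ContDiffAt ℝ 3 u x) :
    DifferentiableAt ℝ (fderiv ℝ (fderiv ℝ u)) x :=
  ((hu.fderiv_right (m := 2) (by norm_num)).fderiv_right (m := 1) (by norm_num)).differentiableAt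
    one_ne_zero

theorem hasDerivAt_hessian {v : EuclideanSpace ℝ (Fin n)} (hu : ContDiffAt ℝ 3 u x) :
    HasDerivAt (fun s : ℝ => hessian u (x + s • v)) (hessianDeriv u x v) 0 := by
  have hd : DifferentiableAt ℝ (fderiv ℝ (fderiv ℝ u)) (x + (0 : ℝ) • v) := by
    simpa using differentiableAt_fderiv_fderiv hu
  have h0 := hasDerivAt_line
    (F := EuclideanSpace ℝ (Fin n) →L[ℝ] EuclideanSpace ℝ (Fin n) →L[ℝ] ℝ) hd
  rw [zero_smul, add_zero] at h0
  refine hasDerivAt_matrix fun i j => ?_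
  have h1 := h0.clm_apply (hasDerivAt_const (0 : ℝ) (EuclideanSpace.single i (1 : ℝ)))
  rw [map_zero, add_zero] at h1
  have h2 := h1.clm_apply (hasDerivAt_const (0 : ℝ) (EuclideanSpace.single j (1 : ℝ)))
  rw [map_zero, add_zero] at h2
  exact h2

theorem eventually_line {p : EuclideanSpace ℝ (Fin n) → Prop} (h : ∀ᶠ y in 𝓝 x, p y)
    (v : EuclideanSpace ℝ (Fin n)) : ∀ᶠ t : ℝ in 𝓝 0, p (x + t • v) := by
  have hc : ContinuousAt (fun t : ℝ => x + t • v) 0 := by fun_prop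
  exact hc.eventually (by simpa using h)

theorem contDiffAt_eventually {m : ℕ} (hu : ContDiffAt ℝ m u x) :
    ∀ᶠ y in 𝓝 x, ContDiffAt ℝ m u y := hu.eventually (by simp)

theorem isSymm_hessianDeriv (hu : ContDiffAt ℝ 3 u x) (v : EuclideanSpace ℝ (Fin n)) :
    (hessianDeriv u x v).IsSymm := by
  have h1 := hasDerivAt_hessian hu (v := v)
  have h2 := (LinearMap.toContinuousLinearMap
    (Matrix.transposeLinearEquiv (Fin n) (Fin n) ℝ ℝ).toLinearMap).hasFDerivAt.comp_hasDerivAt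
      (0 : ℝ) h1
  have hev := eventually_line (contDiffAt_eventually (m := 2) (hu.of_le (by norm_num))) v
  refine h2.unique (h1.congr_of_eventuallyEq ?_)
  filter_upwards [hev] with t ht
  exact isSymm_hessian ht

/-- Symmetry of third derivatives, D³u(v,p,v) = D³u(p,v,v). It turns the second derivative of |Du|²
along v into the quadratic form of the Hessian differentiated along p. -/
theorem hessianDeriv_mulVec_comm (hu : ContDiffAt ℝ 3 u x) (v p : EuclideanSpace ℝ (Fin n)) :
    p.ofLp ⬝ᵥ hessianDeriv u x v *ᵥ v.ofLp = v.ofLp ⬝ᵥ hessianDeriv u x p *ᵥ v.ofLp := by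
  have key : ∀ a b c : EuclideanSpace ℝ (Fin n),
      fderiv ℝ (fderiv ℝ (fderiv ℝ u)) x a b c = b.ofLp ⬝ᵥ hessianDeriv u x a *ᵥ c.ofLp := by
    intro a b c
    rw [apply_eq_sum _ b, _root_.sum_apply, dotProduct]
    refine Finset.sum_congr rfl fun i _ => ?_
    rw [_root_.smul_apply, apply_eq_sum _ c, smul_eq_mul, mulVec, dotProduct]
    congr 1
    exact Finset.sum_congr rfl fun j _ => by rw [hessianDeriv, of_apply, smul_eq_mul, mul_comm]
  have hsym := (hu.fderiv_right (m := 2) (by norm_num)).isSymmSndFDerivAt (by simp) p v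
  rw [← key, ← key, hsym]

/-- The necessary second order condition at a local maximum. -/
theorem second_derivative_nonpos {f f' : ℝ → ℝ} {c : ℝ}
    (hf : ∀ᶠ t in 𝓝 (0 : ℝ), HasDerivAt f (f' t) t) (hf' : HasDerivAt f' c 0)
    (hmax : IsLocalMax f 0) : f' 0 = 0 ∧ c ≤ 0 := by
  have h0 : f' 0 = 0 := hmax.hasDerivAt_eq_zero hf.self_of_nhds
  refine ⟨h0, ?_⟩
  -- A positive second derivative would make 0 a local minimum as well, hence `f` locally constant
  -- with zero second derivative.
  by_contra hc
  push Not at hc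
  have hdf : deriv f =ᶠ[𝓝 0] f' := hf.mono fun t ht => ht.deriv
  have hdd : deriv (deriv f) 0 = c := hdf.deriv_eq.trans hf'.deriv
  have hmin : IsLocalMin f 0 := isLocalMin_of_deriv_deriv_pos (by rw [hdd]; exact hc)
    (by rw [hdf.self_of_nhds, h0]) hf.self_of_nhds.continuousAt
  have hconst : f =ᶠ[𝓝 0] fun _ => f 0 := by
    filter_upwards [hmin, hmax] with t h1 h2
    exact le_antisymm h2 h1
  have : deriv f =ᶠ[𝓝 0] fun _ => 0 := by
    have := hconst.deriv
    simpa using this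
  have h2 : deriv (deriv f) 0 = 0 := by rw [this.deriv_eq]; simp
  linarith

/-- First and second order conditions at a local maximum of a `C²` function. -/
theorem hessian_condition_of_isLocalMax (hu : ContDiffAt ℝ 2 u x) (hmax : IsLocalMax u x) :
    gradVec u x = 0 ∧ ∀ v : Fin n → ℝ, v ⬝ᵥ hessian u x *ᵥ v ≤ 0 := by
  constructor
  · ext i
    rw [gradVec_apply, hmax.fderiv_eq_zero]
    simp
  · intro v
    set v' : EuclideanSpace ℝ (Fin n) := WithLp.toLp 2 v
    have hu0 : ContDiffAt ℝ 2 u (x + (0 : ℝ) • v') := by simpa using hu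
    have hg := hasDerivAt_gradVec hu0
    have hf' : HasDerivAt (fun t : ℝ => v ⬝ᵥ gradVec u (x + t • v'))
        (v ⬝ᵥ hessian u x *ᵥ v) 0 := by
      rw [hasDerivAt_pi] at hg
      simp only [dotProduct]
      have := HasDerivAt.fun_sum (u := Finset.univ) fun i _ => (hg i).const_mul (v i)
      simpa using this
    refine (second_derivative_nonpos (f := fun t : ℝ => u (x + t • v')) ?_ hf' ?_).2
    · filter_upwards [eventually_line (contDiffAt_eventually (m := 2) hu) v'] with t ht
      have := hasDerivAt_line (ht.differentiableAt two_ne_zero)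
      rwa [fderiv_eq_dotProduct, dotProduct_comm] at this
    · have := eventually_line hmax v'
      simpa [IsLocalMax, IsMaxFilter] using this

end Derivatives

/-! ### The maximum principle for log w + Bu. -/

section InteriorEstimate

open Matrix
open scoped Matrix.Norms.Operator Topology

variable {n : ℕ} {u : EuclideanSpace ℝ (Fin n) → ℝ} {x : EuclideanSpace ℝ (Fin n)}

theorem continuousAt_gradVec (hu : ContDiffAt ℝ 1 u x) : ContinuousAt (gradVec u) x := by
  rw [continuousAt_pi]
  intro i
  simp only [gradVec_apply]
  exact (hu.fderiv_right (m := 0) (by norm_num)).continuousAt.clm_apply continuousAt_const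

theorem hasDerivAt_dotProduct {f g : ℝ → Fin n → ℝ} {f' g' : Fin n → ℝ} {t : ℝ}
    (hf : HasDerivAt f f' t) (hg : HasDerivAt g g' t) :
    HasDerivAt (fun s => f s ⬝ᵥ g s) (f' ⬝ᵥ g t + f t ⬝ᵥ g') t := by
  rw [hasDerivAt_pi] at hf hg
  have := HasDerivAt.fun_sum (u := Finset.univ) fun i _ => (hf i).fun_mul (hg i)
  simpa only [dotProduct, ← Finset.sum_add_distrib] using this

theorem hasDerivAt_mulVec {M : ℝ → Matrix (Fin n) (Fin n) ℝ} {M' : Matrix (Fin n) (Fin n) ℝ}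
    {t : ℝ} (hM : HasDerivAt M M' t) (v : Fin n → ℝ) :
    HasDerivAt (fun s => M s *ᵥ v) (M' *ᵥ v) t := by
  let L : Matrix (Fin n) (Fin n) ℝ →ₗ[ℝ] Fin n → ℝ :=
    { toFun := fun N => N *ᵥ v
      map_add' := fun A B => add_mulVec A B v
      map_smul' := fun c A => smul_mulVec c A v }
  have h := (LinearMap.toContinuousLinearMap L).hasFDerivAt.comp_hasDerivAt t hM
  exact h

/-- First and second order conditions at a maximum of `log w + B u`. -/
theorem critical_point_conditions (hu : ContDiffAt ℝ 3 u x)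
    (hp : gradVec u x ⬝ᵥ gradVec u x < 1) {B : ℝ}
    (hmax : IsLocalMax
      (fun y => -(1 / 2) * Real.log (1 - gradVec u y ⬝ᵥ gradVec u y) + B * u y) x) :
    hessian u x *ᵥ gradVec u x =
        (-(B * (1 - gradVec u x ⬝ᵥ gradVec u x))) • gradVec u x ∧
      ∀ v : Fin n → ℝ, v ⬝ᵥ hessianDeriv u x (WithLp.toLp 2 (gradVec u x)) *ᵥ v +
        (hessian u x *ᵥ v) ⬝ᵥ (hessian u x *ᵥ v) + (1 - gradVec u x ⬝ᵥ gradVec u x) *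
          (2 * B ^ 2 * (gradVec u x ⬝ᵥ v) ^ 2 + B * (v ⬝ᵥ hessian u x *ᵥ v)) ≤ 0 := by
  have hu2 : ContDiffAt ℝ 2 u x := hu.of_le (by norm_num)
  set p := gradVec u x with hpdef
  set A := hessian u x with hAdef
  set q := 1 - p ⬝ᵥ p with hq
  have hqpos : 0 < q := by rw [hq]; linarith
  have hA : A.IsSymm := isSymm_hessian hu2
  have key : ∀ v : Fin n → ℝ, p ⬝ᵥ A *ᵥ v = -(B * q) * (p ⬝ᵥ v) ∧
      v ⬝ᵥ hessianDeriv u x (WithLp.toLp 2 p) *ᵥ v + (A *ᵥ v) ⬝ᵥ (A *ᵥ v) +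
        q * (2 * B ^ 2 * (p ⬝ᵥ v) ^ 2 + B * (v ⬝ᵥ A *ᵥ v)) ≤ 0 := by
    intro v
    set v' : EuclideanSpace ℝ (Fin n) := WithLp.toLp 2 v with hv'
    set f' : ℝ → ℝ := fun t =>
      (gradVec u (x + t • v') ⬝ᵥ hessian u (x + t • v') *ᵥ v) /
        (1 - gradVec u (x + t • v') ⬝ᵥ gradVec u (x + t • v')) +
      B * (gradVec u (x + t • v') ⬝ᵥ v) with hf'def
    have hlt : ∀ᶠ y in 𝓝 x, gradVec u y ⬝ᵥ gradVec u y < 1 := by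
      have hc := continuousAt_gradVec (hu.of_le (by norm_num) : ContDiffAt ℝ 1 u x)
      have : ContinuousAt (fun y => gradVec u y ⬝ᵥ gradVec u y) x := by fun_prop
      exact this.eventually (gt_mem_nhds hp)
    have hf : ∀ᶠ t in 𝓝 (0 : ℝ), HasDerivAt
        (fun t : ℝ => -(1 / 2) * Real.log
          (1 - gradVec u (x + t • v') ⬝ᵥ gradVec u (x + t • v')) + B * u (x + t • v'))
        (f' t) t := by
      filter_upwards [eventually_line (contDiffAt_eventually (m := 2) hu2) v',
        eventually_line hlt v'] with t ht1 ht2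
      have hg := hasDerivAt_gradVec (v := v') ht1
      have hm := ((hasDerivAt_dotProduct hg hg).const_sub 1).log (by linarith)
      have hd := hasDerivAt_line (ht1.differentiableAt two_ne_zero) (v := v')
      rw [fderiv_eq_dotProduct] at hd
      convert! (hm.const_mul (-(1 / 2))).add (hd.const_mul B) using 1
      simp only [hf'def, hv']
      rw [dotProduct_comm (hessian u _ *ᵥ _) (gradVec u _)]
      ring
    have hu0 : ContDiffAt ℝ 2 u (x + (0 : ℝ) • v') := by simpa using hu2
    have hg := hasDerivAt_gradVec hu0
    have hh := hasDerivAt_mulVec (hasDerivAt_hessian hu (v := v')) v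
    have hnum := hasDerivAt_dotProduct hg hh
    have hden := (hasDerivAt_dotProduct hg hg).const_sub 1
    have hgv := hasDerivAt_dotProduct hg (hasDerivAt_const (0 : ℝ) v)
    have hf' := (hnum.div hden (by simpa using hqpos.ne')).add (hgv.const_mul B)
    have hmax' := eventually_line hmax v'
    obtain ⟨h1, h2⟩ := second_derivative_nonpos hf hf' (by
      simpa [IsLocalMax, IsMaxFilter] using hmax')
    simp only [hf'def, zero_smul, add_zero, ← hpdef, ← hAdef, ← hq] at h1
    have h3 : p ⬝ᵥ A *ᵥ v = -(B * q) * (p ⬝ᵥ v) := by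
      field_simp at h1
      linear_combination h1
    refine ⟨h3, ?_⟩
    simp only [zero_smul, add_zero, ← hpdef, ← hAdef, ← hq, dotProduct_zero] at h2
    have e1 : v'.ofLp = v := rfl
    have e2 : (p ⬝ᵥ hessianDeriv u x v' *ᵥ v) = v ⬝ᵥ hessianDeriv u x (WithLp.toLp 2 p) *ᵥ v :=
      hessianDeriv_mulVec_comm hu v' (WithLp.toLp 2 p)
    rw [e1, e2, dotProduct_comm (A *ᵥ v) p, h3, dotProduct_comm (A *ᵥ v) v] at h2
    set X := v ⬝ᵥ hessianDeriv u x (WithLp.toLp 2 p) *ᵥ v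
    set Y := (A *ᵥ v) ⬝ᵥ (A *ᵥ v)
    -- The square produced by the quotient rule becomes 2B²q(p·v)² once the first-order relation is
    -- inserted and the inequality is multiplied by q > 0.
    have e3 : (((Y + X) * q - -(B * q) * (p ⬝ᵥ v) *
        -(-(B * q) * (p ⬝ᵥ v) + -(B * q) * (p ⬝ᵥ v))) / q ^ 2 + B * (v ⬝ᵥ A *ᵥ v)) * q =
        X + Y + q * (2 * B ^ 2 * (p ⬝ᵥ v) ^ 2 + B * (v ⬝ᵥ A *ᵥ v)) := by
      field_simp
      ring
    rw [← e3]
    exact mul_nonpos_of_nonpos_of_nonneg h2 hqpos.le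
  refine ⟨?_, fun v => (key v).2⟩
  ext i
  have h := (key (Pi.single i 1)).1
  rw [dotProduct_mulVec, ← mulVec_transpose, hA] at h
  simpa using h

/-- The equation differentiated in the direction of the gradient. -/
theorem hasDerivAt_curvatureOperator {k l : ℕ} (hlk : l < k) (hkn : k ≤ n)
    (hu : ContDiffAt ℝ 3 u x) (hadm : AdmissiblePair k (gradVec u x) (hessian u x))
    (v : EuclideanSpace ℝ (Fin n)) :
    HasDerivAt (fun t : ℝ => curvatureOperator k l (gradVec u (x + t • v), hessian u (x + t • v)))
      (fderiv ℝ (curvatureOperator k l) (gradVec u x, hessian u x)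
        (hessian u x *ᵥ v.ofLp, hessianDeriv u x v)) 0 := by
  have hu0 : ContDiffAt ℝ 2 u (x + (0 : ℝ) • v) := by simpa using hu.of_le (by norm_num)
  have hg := hasDerivAt_gradVec hu0
  have hz := hg.prodMk (hasDerivAt_hessian hu (v := v))
  have hF : HasFDerivAt (curvatureOperator k l)
      (fderiv ℝ (curvatureOperator k l) (gradVec u x, hessian u x))
      (gradVec u (x + (0 : ℝ) • v), hessian u (x + (0 : ℝ) • v)) := by
    simpa using hadm.hasFDerivAt hlk hkn
  have := hF.comp_hasDerivAt (0 : ℝ) hz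
  simp only [zero_smul, add_zero] at this
  exact this

/-- The derivative is D_xψ · Du + ψ_z |Du|². Monotonicity in z makes the second term nonnegative,
and |Du| ≤ 1 bounds the first below by -K. -/
theorem source_derivative_ge {ψ : EuclideanSpace ℝ (Fin n) × ℝ → ℝ} {K : ℝ}
    (hu : DifferentiableAt ℝ u x) (hψ : DifferentiableAt ℝ ψ (x, u x))
    (hK : ‖gradient (fun y => ψ (y, u x)) x‖ ≤ K)
    (hz : 0 ≤ deriv (fun t : ℝ => ψ (x, t)) (u x)) (hp : ‖gradient u x‖ ≤ 1) :
    ∃ d, -K ≤ d ∧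
      HasDerivAt (fun t : ℝ => ψ (x + t • gradient u x, u (x + t • gradient u x))) d 0 := by
  set v := gradient u x with hv
  have h1 : HasDerivAt (fun t : ℝ => x + t • v) v 0 := by
    simpa using ((hasDerivAt_id (0 : ℝ)).smul_const v).const_add x
  have hu0 : DifferentiableAt ℝ u (x + (0 : ℝ) • v) := by simpa using hu
  have h2 := h1.prodMk (hasDerivAt_line hu0)
  have hψ0 : HasFDerivAt ψ (fderiv ℝ ψ (x, u x)) (x + (0 : ℝ) • v, u (x + (0 : ℝ) • v)) := by
    simpa using hψ.hasFDerivAt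
  have h3 := hψ0.comp_hasDerivAt (0 : ℝ) h2
  refine ⟨_, ?_, h3⟩
  rw [zero_smul, add_zero]
  have e : (v, fderiv ℝ u x v) = (v, (0 : ℝ)) +
      fderiv ℝ u x v • ((0 : EuclideanSpace ℝ (Fin n)), (1 : ℝ)) := by simp
  rw [e, map_add, map_smul, smul_eq_mul]
  have hx : HasFDerivAt (fun y : EuclideanSpace ℝ (Fin n) => (y, u x))
      (ContinuousLinearMap.inl ℝ (EuclideanSpace ℝ (Fin n)) ℝ) x :=
    hasFDerivAt_prodMk_left x (u x)
  have hψx : fderiv ℝ (fun y => ψ (y, u x)) x v = fderiv ℝ ψ (x, u x) (v, 0) := by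
    have : HasFDerivAt (fun y => ψ (y, u x)) _ x := hψ.hasFDerivAt.comp x hx
    rw [this.fderiv]; simp
  have hψz : deriv (fun t : ℝ => ψ (x, t)) (u x) = fderiv ℝ ψ (x, u x) (0, 1) := by
    have h4 : HasDerivAt (fun t : ℝ => (x, t)) ((0 : EuclideanSpace ℝ (Fin n)), (1 : ℝ)) (u x) :=
      (hasDerivAt_const _ x).prodMk (hasDerivAt_id _)
    exact (hψ.hasFDerivAt.comp_hasDerivAt (u x) h4).deriv
  have hvv : 0 ≤ fderiv ℝ u x v := by
    rw [← inner_gradient_left, ← hv]; exact real_inner_self_nonneg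
  have hlow : -K ≤ fderiv ℝ ψ (x, u x) (v, 0) := by
    rw [← hψx, ← inner_gradient_left]
    have h5 := abs_real_inner_le_norm (gradient (fun y => ψ (y, u x)) x) v
    have h6 : ‖gradient (fun y => ψ (y, u x)) x‖ * ‖v‖ ≤ K * 1 := by
      gcongr
      exact (norm_nonneg _).trans hK
    linarith [neg_abs_le (inner ℝ (gradient (fun y => ψ (y, u x)) x) v)]
  rw [← hψz]
  linarith [mul_nonneg hvv hz]

/-- The function `log w + B u` has no interior local maximum when `B` is large. -/
theorem not_isLocalMax_log_lorentzFactor_add {k l : ℕ} (hlk : l < k) (hkn : k ≤ n)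
    (hu : ContDiffAt ℝ 3 u x) (hadm : AdmissiblePair k (gradVec u x) (hessian u x))
    {ψ : EuclideanSpace ℝ (Fin n) × ℝ → ℝ} (hψ : DifferentiableAt ℝ ψ (x, u x))
    (heq : ∀ᶠ y in 𝓝 x, curvatureOperator k l (gradVec u y, hessian u y) = ψ (y, u y))
    {K c B : ℝ} (hK : ‖gradient (fun y => ψ (y, u x)) x‖ ≤ K)
    (hz : 0 ≤ deriv (fun t : ℝ => ψ (x, t)) (u x)) (hc : c ≤ ψ (x, u x)) (hc0 : 0 < c)
    (hB : 0 ≤ B) (hBc : K < B * c) :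
    ¬ IsLocalMax
      (fun y => -(1 / 2) * Real.log (1 - gradVec u y ⬝ᵥ gradVec u y) + B * u y) x := by
  intro hmax
  obtain ⟨h1, h2⟩ := critical_point_conditions hu hadm.lt_one hmax
  have hp : ‖gradient u x‖ ≤ 1 := by
    have := hadm.lt_one
    rw [gradVec_dotProduct_self] at this
    nlinarith [norm_nonneg (gradient u x)]
  obtain ⟨d, hd, hder⟩ := source_derivative_ge
    (hu.differentiableAt (by norm_num)) hψ hK hz hp
  have hder2 := hasDerivAt_curvatureOperator (l := l) hlk hkn hu hadm (gradient u x)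
  have hdd := hder2.unique (hder.congr_of_eventuallyEq (eventually_line heq _))
  have e1 : (gradient u x).ofLp = gradVec u x := rfl
  have e2 : WithLp.toLp 2 (gradVec u x) = gradient u x := rfl
  rw [e1, h1] at hdd
  rw [e2] at h2
  have hAs := hadm.symm
  have hT := isSymm_hessianDeriv hu (gradient u x)
  have hle := hadm.fderiv_le (l := l) hlk hkn h1 (T := hessianDeriv u x (gradient u x)) (by
    refine posSemidef_of_forall ?_ fun v => ?_
    · refine IsSymm.neg ((hT.add ?_).add
        (((((isSymm_vecMulVec_self _).smul _).add (hAs.smul _))).smul _))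
      rw [IsSymm, transpose_mul, hAs]
    · have h3 := h2 v
      have e3 : v ⬝ᵥ (hessian u x * hessian u x) *ᵥ v =
          (hessian u x *ᵥ v) ⬝ᵥ (hessian u x *ᵥ v) := by
        rw [← mulVec_mulVec, dotProduct_mulVec, ← mulVec_transpose, hAs]
      have e4 : v ⬝ᵥ vecMulVec (gradVec u x) (gradVec u x) *ᵥ v = (gradVec u x ⬝ᵥ v) ^ 2 := by
        rw [vecMulVec_mulVec, dotProduct_comm v]
        simp [smul_dotProduct, sq]
      simp only [neg_mulVec, add_mulVec, smul_mulVec, dotProduct_neg, dotProduct_add,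
        dotProduct_smul, smul_eq_mul, e3, e4]
      linarith)
  rw [hdd, heq.self_of_nhds] at hle
  have hkl : (1 : ℝ) ≤ ((k - l : ℕ) : ℝ) := by exact_mod_cast (by omega : 1 ≤ k - l)
  have h4 : c ≤ ((k - l : ℕ) : ℝ) * ψ (x, u x) := by nlinarith
  have h5 := mul_le_mul_of_nonneg_left h4 hB
  linarith

end InteriorEstimate

/-! ### Global estimates from the boundary values. -/

section GlobalEstimate

open Matrix
open scoped Topology

variable {n : ℕ} {Ω : Set (EuclideanSpace ℝ (Fin n))} {u : EuclideanSpace ℝ (Fin n) → ℝ}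
  {x : EuclideanSpace ℝ (Fin n)}

theorem IsC1UpToBoundary.continuousOn_gradBar (hu : IsC1UpToBoundary Ω u) :
    ContinuousOn (gradBar Ω u) (closure Ω) :=
  continuousOn_extendFrom subset_rfl hu.exists_limit

theorem gradBar_eq_gradient (hΩ : IsOpen Ω) (hu : ContDiffOn ℝ 1 u Ω) (hx : x ∈ Ω) :
    gradBar Ω u x = gradient u x := by
  have hc : ContinuousOn (gradient u) Ω :=
    (InnerProductSpace.toDual ℝ _).symm.continuous.comp_continuousOn
      (hu.continuousOn_fderiv_of_isOpen hΩ le_rfl)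
  exact extendFrom_extends hc x hx

theorem IsAdmissible.gradVec_lt_one {k : ℕ} (hΩ : IsOpen Ω) (hu : IsAdmissible k Ω u)
    (hx : x ∈ Ω) : gradVec u x ⬝ᵥ gradVec u x < 1 := by
  obtain ⟨s, hs, h⟩ := hu.spacelike
  have h1 := h x (subset_closure hx)
  rw [gradBar_eq_gradient hΩ hu.isC1.contDiffOn hx] at h1
  rw [gradVec_dotProduct_self]
  nlinarith [norm_nonneg (gradient u x)]

theorem IsAdmissible.contDiffAt {k : ℕ} (hΩ : IsOpen Ω) (hu : IsAdmissible k Ω u)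
    (hx : x ∈ Ω) : ContDiffAt ℝ 2 u x :=
  hu.contDiffOn.contDiffAt (hΩ.mem_nhds hx)

theorem IsAdmissible.admissiblePair {k : ℕ} (hkn : k ≤ n) (hΩ : IsOpen Ω)
    (hu : IsAdmissible k Ω u) (hx : x ∈ Ω) : AdmissiblePair k (gradVec u x) (hessian u x) :=
  admissiblePair_of_mem hkn (hu.gradVec_lt_one hΩ hx) (isSymm_hessian (hu.contDiffAt hΩ hx))
    (hu.convex x hx)

theorem IsAdmissible.quotientCurvature_eq {k l : ℕ} (hlk : l < k) (hkn : k ≤ n) (hΩ : IsOpen Ω)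
    (hu : IsAdmissible k Ω u) (hx : x ∈ Ω) :
    quotientCurvature k l u x = curvatureOperator k l (gradVec u x, hessian u x) :=
  MinkowskiGraph.quotientCurvature_eq hlk hkn (hu.gradVec_lt_one hΩ hx)
    (isSymm_hessian (hu.contDiffAt hΩ hx))

theorem IsMonotoneSource.contDiffAt {ψ : EuclideanSpace ℝ (Fin n) × ℝ → ℝ} (hΩ : IsOpen Ω)
    (hψ : IsMonotoneSource Ω ψ) (hx : x ∈ Ω) (z : ℝ) : ContDiffAt ℝ 1 ψ (x, z) := by
  refine (hψ.smooth.contDiffAt ?_).of_le (by exact_mod_cast le_top)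
  exact Filter.mem_of_superset ((hΩ.prod isOpen_univ).mem_nhds ⟨hx, trivial⟩)
    (Set.prod_mono subset_closure subset_rfl)

theorem one_sub_norm_sq_pos {k : ℕ} (hu : IsAdmissible k Ω u) (hx : x ∈ closure Ω) :
    0 < 1 - ‖gradBar Ω u x‖ ^ 2 := by
  obtain ⟨s, hs, h⟩ := hu.spacelike
  have h1 := h x hx
  nlinarith [norm_nonneg (gradBar Ω u x)]

theorem wTilde_eq_exp {k : ℕ} (hu : IsAdmissible k Ω u) (hx : x ∈ closure Ω) :
    wTilde Ω u x = Real.exp (-(1 / 2) * Real.log (1 - ‖gradBar Ω u x‖ ^ 2)) := by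
  have h := one_sub_norm_sq_pos hu hx
  rw [wTilde, neg_mul, Real.exp_neg, one_div, mul_comm, ← Real.rpow_def_of_pos h,
    Real.sqrt_eq_rpow]

theorem isCompact_closure (hb : Bornology.IsBounded Ω) : IsCompact (closure Ω) :=
  Metric.isCompact_of_isClosed_isBounded isClosed_closure hb.closure

theorem mem_or_mem_frontier (hΩ : IsOpen Ω) (hx : x ∈ closure Ω) : x ∈ Ω ∨ x ∈ frontier Ω := by
  by_cases h : x ∈ Ω
  · exact Or.inl h
  · exact Or.inr ⟨hx, by rwa [hΩ.interior_eq]⟩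

/-- The maximum of `w e^{Bu}` is attained on the boundary. -/
theorem wTilde_mul_exp_le {k l : ℕ} (hlk : l < k) (hkn : k ≤ n) (hΩ : IsOpen Ω)
    (hb : Bornology.IsBounded Ω) {ψ : EuclideanSpace ℝ (Fin n) × ℝ → ℝ}
    (hψ : IsMonotoneSource Ω ψ) (hu3 : ContDiffOn ℝ 3 u Ω)
    (hu : IsAdmissibleSolution k l Ω ψ u) {K c M B : ℝ} (hbd : HasBounds K c M Ω ψ u)
    (hc0 : 0 < c) (hB : 0 ≤ B) (hBc : K < B * c) (hx : x ∈ closure Ω) :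
    ∃ y ∈ frontier Ω, wTilde Ω u x * Real.exp (B * u x) ≤ wTilde Ω u y := by
  set φ : EuclideanSpace ℝ (Fin n) → ℝ := fun y =>
    -(1 / 2) * Real.log (1 - ‖gradBar Ω u y‖ ^ 2) + B * u y with hφ
  have hcont : ContinuousOn φ (closure Ω) := by
    refine (continuousOn_const.mul (ContinuousOn.log ?_ ?_)).add
      (continuousOn_const.mul hu.admissible.isC1.continuousOn)
    · exact continuousOn_const.sub (hu.admissible.isC1.continuousOn_gradBar.norm.pow 2)
    · exact fun y hy => (one_sub_norm_sq_pos hu.admissible hy).ne'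
  obtain ⟨y, hy, hmax⟩ := (isCompact_closure hb).exists_isMaxOn ⟨x, hx⟩ hcont
  have hφe : ∀ z ∈ closure Ω, wTilde Ω u z * Real.exp (B * u z) = Real.exp (φ z) := by
    intro z hz
    rw [wTilde_eq_exp hu.admissible hz, ← Real.exp_add]
  rcases mem_or_mem_frontier hΩ hy with hyΩ | hyf
  · exfalso
    have hloc : IsLocalMax φ y :=
      (hmax.on_subset subset_closure).isLocalMax (hΩ.mem_nhds hyΩ)
    have hM := hbd.abs_le y hy
    refine not_isLocalMax_log_lorentzFactor_add (l := l) hlk hkn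
      (hu3.contDiffAt (hΩ.mem_nhds hyΩ)) (hu.admissible.admissiblePair hkn hΩ hyΩ)
      ((hψ.contDiffAt hΩ hyΩ _).differentiableAt one_ne_zero) ?_
      (hbd.grad_le y hyΩ _ hM) (hψ.deriv_nonneg y hyΩ _) (hbd.le_source y hyΩ _ hM) hc0 hB hBc ?_
    · filter_upwards [hΩ.mem_nhds hyΩ] with z hz
      rw [← hu.admissible.quotientCurvature_eq hlk hkn hΩ hz, hu.equation z hz]
    · refine hloc.congr ?_
      filter_upwards [hΩ.mem_nhds hyΩ] with z hz
      rw [hφ]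
      simp only
      rw [gradBar_eq_gradient hΩ hu.admissible.isC1.contDiffOn hz, gradVec_dotProduct_self]
  · refine ⟨y, hyf, ?_⟩
    rw [hφe x hx]
    calc Real.exp (φ x) ≤ Real.exp (φ y) := Real.exp_le_exp.2 (hmax hx)
      _ = wTilde Ω u y * Real.exp (B * u y) := (hφe y hy).symm
      _ = wTilde Ω u y := by rw [hu.boundary y hyf]; simp

theorem wTilde_le_of_norm_le {s : ℝ} (hs : s < 1) (h : ‖gradBar Ω u x‖ ≤ s) :
    wTilde Ω u x ≤ 1 / √(1 - s ^ 2) := by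
  have h0 := norm_nonneg (gradBar Ω u x)
  have h1 : 0 < 1 - s ^ 2 := by nlinarith
  have h2 : ‖gradBar Ω u x‖ ^ 2 ≤ s ^ 2 := by gcongr
  exact one_div_le_one_div_of_le (Real.sqrt_pos.2 h1) (Real.sqrt_le_sqrt (by linarith))

theorem wTilde_nonneg : 0 ≤ wTilde Ω u x := by rw [wTilde]; positivity

/-- The global gradient estimate. -/
theorem gradient_estimate {k l : ℕ} (hlk : l < k) (hkn : k ≤ n) (K c M : ℝ) (hc : 0 < c) :
    ∃ C : ℝ, 0 < C ∧
      ∀ (Ω : Set (EuclideanSpace ℝ (Fin n))) (ψ : EuclideanSpace ℝ (Fin n) × ℝ → ℝ)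
        (u : EuclideanSpace ℝ (Fin n) → ℝ),
        IsOpen Ω → Bornology.IsBounded Ω → IsMonotoneSource Ω ψ →
        ContDiffOn ℝ 3 u Ω → IsAdmissibleSolution k l Ω ψ u → HasBounds K c M Ω ψ u →
        ∀ x ∈ closure Ω, wTilde Ω u x ≤ C * (1 + sSup (wTilde Ω u '' frontier Ω)) := by
  -- This choice gives Bc = |K| + 1 > K. Since |u| ≤ M, passing from w e^{Bu} to w costs at most
  -- e^{BM}.
  set B := (|K| + 1) / c with hBdef
  have hB : 0 ≤ B := by positivity
  have hBc : K < B * c := by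
    rw [hBdef, div_mul_cancel₀ _ hc.ne']
    linarith [le_abs_self K]
  refine ⟨Real.exp (B * M), Real.exp_pos _, ?_⟩
  intro Ω ψ u hΩ hb hψ hu3 hu hbd x hx
  obtain ⟨y, hy, hle⟩ := wTilde_mul_exp_le hlk hkn hΩ hb hψ hu3 hu hbd hc hB hBc hx
  obtain ⟨s, hs, hsb⟩ := hu.admissible.spacelike
  have hbdd : BddAbove (wTilde Ω u '' frontier Ω) := by
    refine ⟨1 / √(1 - s ^ 2), ?_⟩
    rintro _ ⟨z, hz, rfl⟩
    exact wTilde_le_of_norm_le hs (hsb z (frontier_subset_closure hz))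
  have h1 : wTilde Ω u y ≤ sSup (wTilde Ω u '' frontier Ω) := le_csSup hbdd ⟨y, hy, rfl⟩
  have h2 : 1 ≤ Real.exp (B * M) * Real.exp (B * u x) := by
    rw [← Real.exp_add, Real.one_le_exp_iff, ← mul_add]
    exact mul_nonneg hB (by linarith [(abs_le.1 (hbd.abs_le x hx)).1])
  calc wTilde Ω u x ≤ (Real.exp (B * M) * Real.exp (B * u x)) * wTilde Ω u x :=
        le_mul_of_one_le_left wTilde_nonneg h2
    _ = Real.exp (B * M) * (wTilde Ω u x * Real.exp (B * u x)) := by ring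
    _ ≤ Real.exp (B * M) * (1 + sSup (wTilde Ω u '' frontier Ω)) := by gcongr; linarith

/-- A bound of the boundary gradient gives a global spacelike bound. -/
theorem spacelike_estimate {k l : ℕ} (hlk : l < k) (hkn : k ≤ n) (K c M θ : ℝ) (hc : 0 < c)
    (hθ : 0 < θ) (hθ1 : θ < 1) : ∃ θ₀ : ℝ, 0 < θ₀ ∧ θ₀ < 1 ∧
      ∀ (Ω : Set (EuclideanSpace ℝ (Fin n))) (ψ : EuclideanSpace ℝ (Fin n) × ℝ → ℝ)
        (u : EuclideanSpace ℝ (Fin n) → ℝ),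
        IsOpen Ω → Bornology.IsBounded Ω → IsMonotoneSource Ω ψ →
        ContDiffOn ℝ 3 u Ω → IsAdmissibleSolution k l Ω ψ u → HasBounds K c M Ω ψ u →
        (∀ x ∈ frontier Ω, ‖gradBar Ω u x‖ ≤ 1 - θ) →
        ∀ x ∈ closure Ω, ‖gradBar Ω u x‖ ≤ 1 - θ₀ := by
  obtain ⟨C, hC, hest⟩ := gradient_estimate hlk hkn K c M hc
  -- An upper bound for w over the closure; the summand 2 ensures 1/W² < 1. Solving w ≤ W gives
  -- |Du|² ≤ 1 - 1/W².
  set W := 2 + C * (1 + 1 / √(1 - (1 - θ) ^ 2)) with hW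
  have hW2 : 2 ≤ W := by
    have : 0 ≤ C * (1 + 1 / √(1 - (1 - θ) ^ 2)) := by positivity
    linarith
  have hWi : 0 < 1 / W ^ 2 := by positivity
  have hWi1 : 1 / W ^ 2 < 1 := by
    rw [div_lt_one (by positivity)]; nlinarith
  have hs0 : 0 < √(1 - 1 / W ^ 2) := Real.sqrt_pos.2 (by linarith)
  have hs1 : √(1 - 1 / W ^ 2) < 1 := by
    rw [Real.sqrt_lt' one_pos]; linarith
  refine ⟨1 - √(1 - 1 / W ^ 2), by linarith, by linarith, ?_⟩
  intro Ω ψ u hΩ hb hψ hu3 hu hbd hθb x hx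
  have h1 := hest Ω ψ u hΩ hb hψ hu3 hu hbd x hx
  have h2 : sSup (wTilde Ω u '' frontier Ω) ≤ 1 / √(1 - (1 - θ) ^ 2) := by
    -- Nonnegativity of the bound covers the empty boundary, where the supremum is 0.
    refine Real.sSup_le ?_ (by positivity)
    rintro _ ⟨z, hz, rfl⟩
    exact wTilde_le_of_norm_le (by linarith) (hθb z hz)
  have h3 : wTilde Ω u x ≤ W := by
    refine h1.trans ?_
    have : C * (1 + sSup (wTilde Ω u '' frontier Ω)) ≤ C * (1 + 1 / √(1 - (1 - θ) ^ 2)) := by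
      gcongr
    linarith
  have hq := one_sub_norm_sq_pos hu.admissible hx
  rw [wTilde, div_le_iff₀ (Real.sqrt_pos.2 hq)] at h3
  rw [sub_sub_cancel]
  refine Real.le_sqrt_of_sq_le ?_
  have h4 : 1 / W ≤ √(1 - ‖gradBar Ω u x‖ ^ 2) := by
    rw [div_le_iff₀ (by linarith)]; linarith
  have h5 : (1 / W) ^ 2 ≤ 1 - ‖gradBar Ω u x‖ ^ 2 := by
    rw [← Real.sq_sqrt hq.le]; gcongr
  rw [div_pow, one_pow] at h5
  linarith

end GlobalEstimate

/-! ### The sign of solutions and the comparison principle. -/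

section Comparison

open Matrix
open scoped Matrix.Norms.Operator Topology

variable {n : ℕ} {Ω : Set (EuclideanSpace ℝ (Fin n))} {u v : EuclideanSpace ℝ (Fin n) → ℝ}
  {x : EuclideanSpace ℝ (Fin n)}

/-- Admissible functions vanishing on the boundary are nonpositive. -/
theorem IsAdmissible.nonpos {k : ℕ} (hk : 1 ≤ k) (hkn : k ≤ n) (hΩ : IsOpen Ω)
    (hb : Bornology.IsBounded Ω) (hu : IsAdmissible k Ω u) (h0 : ∀ x ∈ frontier Ω, u x = 0)
    (hx : x ∈ closure Ω) : u x ≤ 0 := by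
  obtain ⟨y, hy, hmax⟩ := (isCompact_closure hb).exists_isMaxOn ⟨x, hx⟩ hu.isC1.continuousOn
  rcases mem_or_mem_frontier hΩ hy with hyΩ | hyf
  · exfalso
    have hloc : IsLocalMax u y :=
      (hmax.on_subset subset_closure).isLocalMax (hΩ.mem_nhds hyΩ)
    obtain ⟨h1, h2⟩ := hessian_condition_of_isLocalMax (hu.contDiffAt hΩ hyΩ) hloc
    -- At a critical point the shape matrix is the Hessian itself, so the σ_1 condition reads (n-1)
    -- tr D²u > 0, against D²u ≤ 0.
    have hadm := (hu.admissiblePair hkn hΩ hyΩ).gamma 1 le_rfl hk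
    rw [h1, sigma_one (by omega), complementaryMatrix_apply, trace_sub, trace_smul, trace_one,
      Fintype.card_fin, smul_eq_mul] at hadm
    have hW : shapeMatrix 0 (hessian u y) = hessian u y := by
      simp [shapeMatrix_apply, sqrtInvMetric, lorentzFactor]
    have htr : (hessian u y).trace ≤ 0 := by
      refine Finset.sum_nonpos fun i _ => ?_
      have := h2 (Pi.single i 1)
      simpa using this
    rw [hW] at hadm
    have hn : (1 : ℝ) ≤ n := by exact_mod_cast (by omega : 1 ≤ n)
    nlinarith
  · exact (hmax hx).trans (h0 y hyf).le

theorem gradVec_add (hu : DifferentiableAt ℝ u x) (hv : DifferentiableAt ℝ v x) :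
    gradVec (fun y => u y + v y) x = gradVec u x + gradVec v x := by
  ext i
  simp only [gradVec_apply, Pi.add_apply]
  rw [fderiv_fun_add hu hv, _root_.add_apply]

theorem gradVec_neg : gradVec (fun y => -u y) x = -gradVec u x := by
  ext i
  simp only [gradVec_apply, Pi.neg_apply]
  rw [fderiv_fun_neg, _root_.neg_apply]

theorem differentiableAt_fderiv (hu : ContDiffAt ℝ 2 u x) : DifferentiableAt ℝ (fderiv ℝ u) x :=
  (hu.fderiv_right (m := 1) le_rfl).differentiableAt one_ne_zero

theorem hessian_add (hu : ContDiffAt ℝ 2 u x) (hv : ContDiffAt ℝ 2 v x) :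
    hessian (fun y => u y + v y) x = hessian u x + hessian v x := by
  have h : fderiv ℝ (fun y => u y + v y) =ᶠ[𝓝 x] fun y => fderiv ℝ u y + fderiv ℝ v y := by
    filter_upwards [contDiffAt_eventually (m := 2) hu, contDiffAt_eventually (m := 2) hv]
      with y h1 h2
    exact fderiv_fun_add (h1.differentiableAt two_ne_zero) (h2.differentiableAt two_ne_zero)
  ext i j
  rw [hessian_apply, h.fderiv_eq,
    fderiv_fun_add (differentiableAt_fderiv hu) (differentiableAt_fderiv hv)]
  rfl

theorem hessian_neg : hessian (fun y => -u y) x = -hessian u x := by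
  ext i j
  have h : fderiv ℝ (fun y => -u y) = fun y => -fderiv ℝ u y := funext fun y => fderiv_fun_neg
  rw [hessian_apply, h, fderiv_fun_neg]
  rfl

theorem contDiff_exp_coord (i : Fin n) (α β : ℝ) :
    ContDiff ℝ 2 fun y : EuclideanSpace ℝ (Fin n) => Real.exp (α * (y i - β)) := by
  fun_prop

theorem fderiv_exp_coord (i : Fin n) (α β : ℝ) (y : EuclideanSpace ℝ (Fin n)) :
    fderiv ℝ (fun y : EuclideanSpace ℝ (Fin n) => Real.exp (α * (y i - β))) y =
      (α * Real.exp (α * (y i - β))) •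
        (EuclideanSpace.proj i : EuclideanSpace ℝ (Fin n) →L[ℝ] ℝ) := by
  have h1 : HasFDerivAt (fun y : EuclideanSpace ℝ (Fin n) => y i)
      (EuclideanSpace.proj i : EuclideanSpace ℝ (Fin n) →L[ℝ] ℝ) y :=
    (EuclideanSpace.proj i : EuclideanSpace ℝ (Fin n) →L[ℝ] ℝ).hasFDerivAt
  have h2 := ((h1.sub_const β).const_mul α).exp
  rw [h2.fderiv, smul_smul, mul_comm]

theorem gradVec_exp_coord (i : Fin n) (α β : ℝ) (y : EuclideanSpace ℝ (Fin n)) :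
    gradVec (fun y : EuclideanSpace ℝ (Fin n) => Real.exp (α * (y i - β))) y =
      (α * Real.exp (α * (y i - β))) • Pi.single i 1 := by
  ext j
  rw [gradVec_apply, fderiv_exp_coord]
  simp [Pi.single_apply, eq_comm]

theorem hessian_exp_coord (i : Fin n) (α β : ℝ) (y : EuclideanSpace ℝ (Fin n)) :
    hessian (fun y : EuclideanSpace ℝ (Fin n) => Real.exp (α * (y i - β))) y =
      (α * (α * Real.exp (α * (y i - β)))) •
        vecMulVec (Pi.single i (1 : ℝ)) (Pi.single i (1 : ℝ)) := by
  have h1 : DifferentiableAt ℝ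
      (fun y : EuclideanSpace ℝ (Fin n) => Real.exp (α * (y i - β))) y :=
    (contDiff_exp_coord i α β).contDiffAt.differentiableAt two_ne_zero
  have h2 := h1.hasFDerivAt
  rw [fderiv_exp_coord] at h2
  have h3 := (h2.const_mul α).smul_const
    (EuclideanSpace.proj i : EuclideanSpace ℝ (Fin n) →L[ℝ] ℝ)
  ext j m
  rw [hessian_apply, funext (fderiv_exp_coord i α β), h3.fderiv, ContinuousLinearMap.smulRight_apply]
  change α * (α * Real.exp (α * (y i - β)) * (EuclideanSpace.single j (1 : ℝ)) i) *
    (EuclideanSpace.single m (1 : ℝ)) i = α * (α * Real.exp (α * (y i - β))) *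
      (Pi.single (M := fun _ => ℝ) i 1 j * Pi.single (M := fun _ => ℝ) i 1 m)
  simp only [PiLp.single_apply, Pi.single_apply, eq_comm (a := i)]
  ring

/-- Strict ellipticity, in the form needed for the comparison principle: perturbing the Hessian by
much more than the gradient strictly increases the curvature. -/
theorem eventually_curvatureOperator_lt {k l : ℕ} (hlk : l < k) (hkn : k ≤ n) (hn : 2 ≤ n)
    {q : Fin n → ℝ} {A : Matrix (Fin n) (Fin n) ℝ} (h : AdmissiblePair k q A)
    {e : Fin n → ℝ} (he : e ≠ 0) {a : ℕ → Fin n → ℝ} {b : ℕ → Matrix (Fin n) (Fin n) ℝ}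
    (ha : Filter.Tendsto a Filter.atTop (𝓝 q)) (hb : Filter.Tendsto b Filter.atTop (𝓝 A))
    {α δ : ℕ → ℝ} (hα : Filter.Tendsto α Filter.atTop Filter.atTop) (hα1 : ∀ j, 1 ≤ α j)
    (hδ : ∀ j, 0 < δ j) (hδα : Filter.Tendsto (fun j => α j * δ j) Filter.atTop (𝓝 0)) :
    Filter.Tendsto (fun j => (a j + δ j • e, b j + (α j * δ j) • vecMulVec e e)) Filter.atTop
      (𝓝 (q, A)) ∧
    ∀ᶠ j in Filter.atTop, curvatureOperator k l (a j, b j) <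
      curvatureOperator k l (a j + δ j • e, b j + (α j * δ j) • vecMulVec e e) := by
  set P := vecMulVec e e with hP
  have hPs : P.PosSemidef := by
    simpa using (posSemidef_vecMulVec_self_star e : (vecMulVec e (star e)).PosSemidef)
  have hP0 : P ≠ 0 := by
    obtain ⟨i, hi⟩ := Function.ne_iff.1 he
    intro h0
    have := congrFun (congrFun h0 i) i
    exact hi (mul_self_eq_zero.1 this)
  have hδ0 : Filter.Tendsto δ Filter.atTop (𝓝 0) := by
    refine squeeze_zero (fun j => (hδ j).le) (fun j => ?_) hδα
    nlinarith [hδ j, hα1 j]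
  have hz : Filter.Tendsto (fun j => (a j + δ j • e, b j + (α j * δ j) • P)) Filter.atTop
      (𝓝 (q, A)) := by
    have h1 := ha.add (hδ0.smul_const e)
    have h2 := hb.add (hδα.smul_const P)
    simp only [zero_smul, add_zero] at h1 h2
    exact h1.prodMk_nhds h2
  refine ⟨hz, ?_⟩
  -- Strict differentiability is needed because both the base points and the perturbed points move
  -- with j.
  have hstrict : HasStrictFDerivAt (curvatureOperator k l)
      (fderiv ℝ (curvatureOperator k l) (q, A)) (q, A) :=
    (h.contDiffAt hlk hkn).hasStrictFDerivAt one_ne_zero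
  set L := fderiv ℝ (curvatureOperator k l) (q, A) with hL
  have hlam : 0 < L (0, P) := h.fderiv_pos hlk hkn hn hPs hP0
  set lam := L (0, P) with hlamdef
  set C : ℝ := ‖((e, 0) : (Fin n → ℝ) × Matrix (Fin n) (Fin n) ℝ)‖ +
    ‖((0, P) : (Fin n → ℝ) × Matrix (Fin n) (Fin n) ℝ)‖ with hC
  have hC0 : 0 ≤ C := by positivity
  -- The increment is s = αδ times a bounded vector. The linear part gains at least s·lam/2 once α
  -- is large, and this ε keeps the remainder below s·lam/4.
  set ε := lam / (4 * (C + 1)) with hε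
  have hε0 : 0 < ε := by positivity
  have hεC : ε * C ≤ lam / 4 := by
    rw [hε, div_mul_eq_mul_div, div_le_div_iff₀ (by positivity) (by norm_num)]
    nlinarith
  have hlo := hstrict.isLittleO.def hε0
  have hpair := hz.prodMk_nhds (ha.prodMk_nhds hb)
  have hev1 := hpair.eventually hlo
  have hev2 : ∀ᶠ j in Filter.atTop, |(α j)⁻¹ * L (e, 0)| < lam / 2 := by
    have h1 : Filter.Tendsto (fun j => |(α j)⁻¹ * L (e, 0)|) Filter.atTop (𝓝 0) := by
      have := ((tendsto_inv_atTop_zero.comp hα).mul_const (L (e, 0))).abs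
      simpa using this
    exact h1.eventually (gt_mem_nhds (by positivity))
  filter_upwards [hev1, hev2] with j hj1 hj2
  have hαj : 0 < α j := by linarith [hα1 j]
  set s := α j * δ j with hs
  have hs0 : 0 < s := mul_pos hαj (hδ j)
  have hdiff : ((a j + δ j • e, b j + s • P) : (Fin n → ℝ) × Matrix (Fin n) (Fin n) ℝ) -
      (a j, b j) = s • ((α j)⁻¹ • (e, 0) + (0, P)) := by
    have : s * (α j)⁻¹ = δ j := by rw [hs]; field_simp
    ext1
    · simp [smul_smul, this]
    · simp
  have hLs : L (s • ((α j)⁻¹ • (e, 0) + (0, P))) = s * ((α j)⁻¹ * L (e, 0) + lam) := by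
    rw [L.map_smul, L.map_add, L.map_smul, smul_eq_mul, smul_eq_mul]
  simp only [hdiff, norm_smul] at hj1
  have hnorm : ‖(α j)⁻¹ • ((e, 0) : (Fin n → ℝ) × Matrix (Fin n) (Fin n) ℝ) + (0, P)‖ ≤ C := by
    refine (norm_add_le _ _).trans ?_
    rw [hC, norm_smul]
    gcongr
    refine mul_le_of_le_one_left (norm_nonneg _) ?_
    rw [Real.norm_of_nonneg (by positivity)]
    exact inv_le_one_of_one_le₀ (hα1 j)
  rw [Real.norm_of_nonneg hs0.le] at hj1
  have h3 : -(ε * (s * ‖(α j)⁻¹ • ((e, 0) : (Fin n → ℝ) × Matrix (Fin n) (Fin n) ℝ) + (0, P)‖)) ≤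
      curvatureOperator k l (a j + δ j • e, b j + s • P) - curvatureOperator k l (a j, b j) -
        s * ((α j)⁻¹ * L (e, 0) + lam) := by
    rw [← hLs]
    exact (abs_le.1 hj1).1
  have h4 : ε * (s * ‖(α j)⁻¹ • ((e, 0) : (Fin n → ℝ) × Matrix (Fin n) (Fin n) ℝ) + (0, P)‖) ≤
      s * (lam / 4) := by
    calc _ = s * (ε * ‖(α j)⁻¹ • ((e, 0) : (Fin n → ℝ) × Matrix (Fin n) (Fin n) ℝ) + (0, P)‖) := by
          ring
      _ ≤ s * (ε * C) := by gcongr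
      _ ≤ _ := by gcongr
  have h5 : s * (lam / 2) ≤ s * ((α j)⁻¹ * L (e, 0) + lam) := by
    gcongr
    linarith [(abs_lt.1 hj2).1]
  have h6 : 0 < s * lam := by positivity
  linarith

theorem continuousAt_hessian (hu : ContDiffAt ℝ 2 u x) : ContinuousAt (hessian u) x := by
  have h := ((hu.fderiv_right (m := 1) le_rfl).fderiv_right (m := 0) (by norm_num)).continuousAt
  refine continuousAt_pi.2 fun i => continuousAt_pi.2 fun j => ?_
  exact (h.clm_apply continuousAt_const).clm_apply continuousAt_const

theorem IsMonotoneSource.monotone {ψ : EuclideanSpace ℝ (Fin n) × ℝ → ℝ} (hΩ : IsOpen Ω)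
    (hψ : IsMonotoneSource Ω ψ) (hx : x ∈ Ω) : Monotone fun t : ℝ => ψ (x, t) := by
  refine monotone_of_deriv_nonneg (fun t => ?_) (fun t => hψ.deriv_nonneg x hx t)
  have h1 : DifferentiableAt ℝ (fun s : ℝ => (x, s)) t := by fun_prop
  exact ((hψ.contDiffAt hΩ hx t).differentiableAt one_ne_zero).comp t h1

/-- The comparison principle. -/
theorem subsolution_le {k l : ℕ} (hlk : l < k) (hkn : k ≤ n) (hn : 2 ≤ n) (hΩ : IsOpen Ω)
    (hb : Bornology.IsBounded Ω) {ψ : EuclideanSpace ℝ (Fin n) × ℝ → ℝ}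
    (hψ : IsMonotoneSource Ω ψ) (hu : IsAdmissibleSolution k l Ω ψ u)
    (hv : IsAdmissibleSubsolution k l Ω ψ v) (hx : x ∈ closure Ω) : v x ≤ u x := by
  by_contra hcon
  push Not at hcon
  set m := v x - u x with hm
  have hm0 : 0 < m := by rw [hm]; linarith
  set i : Fin n := ⟨0, by omega⟩
  obtain ⟨R, hR1, hR⟩ : ∃ R : ℝ, 1 ≤ R ∧ ∀ y ∈ closure Ω, y i ≤ R := by
    obtain ⟨R, hR⟩ := hb.closure.exists_norm_le
    refine ⟨max R 1, le_max_right _ _, fun y hy => ?_⟩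
    have h1 : ‖y i‖ ≤ ‖y‖ := PiLp.norm_apply_le y i
    exact ((le_abs_self _).trans h1).trans ((hR y hy).trans (le_max_left _ _))
  set α : ℕ → ℝ := fun j => (j : ℝ) + 1 with hα
  have hα1 : ∀ j, 1 ≤ α j := fun j => by simp [hα]
  have hαt : Filter.Tendsto α Filter.atTop Filter.atTop :=
    Filter.tendsto_atTop_add_const_right _ _ tendsto_natCast_atTop_atTop
  -- The shift 2R gives y_i - 2R ≤ -1 on the closure, so E and its first two derivatives tend to 0
  -- there. Its second derivative is α times its first, so the Hessian perturbation dominates the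
  -- gradient perturbation.
  set E : ℕ → EuclideanSpace ℝ (Fin n) → ℝ := fun j y => Real.exp (α j * (y i - 2 * R)) with hE
  have hEle : ∀ j, ∀ y ∈ closure Ω, E j y ≤ Real.exp (-α j) := by
    intro j y hy
    refine Real.exp_le_exp.2 ?_
    nlinarith [hR y hy, hα1 j]
  have hcu := hu.admissible.isC1.continuousOn
  have hcv := hv.admissible.isC1.continuousOn
  have hmaxex : ∀ j, ∃ y ∈ closure Ω, IsMaxOn (fun y => v y + -u y + E j y) (closure Ω) y := by
    intro j
    refine (isCompact_closure hb).exists_isMaxOn ⟨x, hx⟩ ((hcv.add hcu.neg).add ?_)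
    exact (contDiff_exp_coord i (α j) (2 * R)).continuous.continuousOn
  choose y hy hymax using hmaxex
  obtain ⟨z, hz, φ, hφ, hyz⟩ := (isCompact_closure hb).tendsto_subseq hy
  have hexp : Filter.Tendsto (fun j => Real.exp (-α j)) Filter.atTop (𝓝 0) :=
    Real.tendsto_exp_neg_atTop_nhds_zero.comp hαt
  have hlow : ∀ j, m - Real.exp (-α j) ≤ v (y j) - u (y j) := by
    intro j
    have h1 : v x + -u x + E j x ≤ v (y j) + -u (y j) + E j (y j) := hymax j hx
    have h2 := hEle j (y j) (hy j)
    have h3 : 0 < E j x := Real.exp_pos _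
    linarith
  have hyzw : Filter.Tendsto (y ∘ φ) Filter.atTop (𝓝[closure Ω] z) :=
    tendsto_nhdsWithin_iff.2 ⟨hyz, Filter.Eventually.of_forall fun j => hy _⟩
  have hlimit : m ≤ v z - u z := by
    have h1 := ((hcv z hz).sub (hcu z hz)).tendsto.comp hyzw
    have h2 : Filter.Tendsto (fun j => m - Real.exp (-α (φ j))) Filter.atTop (𝓝 (m - 0)) :=
      tendsto_const_nhds.sub (hexp.comp hφ.tendsto_atTop)
    rw [sub_zero] at h2
    exact le_of_tendsto_of_tendsto' h2 h1 fun j => hlow _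
  -- The limit keeps v - u ≥ m > 0, while both functions vanish on the boundary.
  have hzΩ : z ∈ Ω := by
    rcases mem_or_mem_frontier hΩ hz with h | h
    · exact h
    · rw [hu.boundary z h, hv.boundary z h] at hlimit
      linarith
  have hvz := hv.admissible.contDiffAt hΩ hzΩ
  set δ : ℕ → ℝ := fun j => α (φ j) * E (φ j) (y (φ j)) with hδ
  have hδpos : ∀ j, 0 < δ j := fun j =>
    mul_pos (by linarith [hα1 (φ j)]) (Real.exp_pos _)
  have hδα : Filter.Tendsto (fun j => α (φ j) * δ j) Filter.atTop (𝓝 0) := by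
    have h1 : Filter.Tendsto (fun j => α (φ j) ^ 2 * Real.exp (-α (φ j))) Filter.atTop (𝓝 0) :=
      (Real.tendsto_pow_mul_exp_neg_atTop_nhds_zero 2).comp (hαt.comp hφ.tendsto_atTop)
    refine squeeze_zero (fun j => ?_) (fun j => ?_) h1
    · exact (mul_pos (by linarith [hα1 (φ j)]) (hδpos j)).le
    · rw [hδ]
      simp only
      rw [← mul_assoc, ← sq]
      gcongr
      exact hEle _ _ (hy _)
  have he : (Pi.single i 1 : Fin n → ℝ) ≠ 0 := by simp
  have hadmz := hv.admissible.admissiblePair hkn hΩ hzΩ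
  obtain ⟨ht, hlt⟩ := eventually_curvatureOperator_lt (l := l) hlk hkn hn hadmz he
    (a := fun j => gradVec v (y (φ j))) (b := fun j => hessian v (y (φ j)))
    ((continuousAt_gradVec (hvz.of_le (by norm_num))).tendsto.comp hyz)
    ((continuousAt_hessian hvz).tendsto.comp hyz) (α := fun j => α (φ j))
    (hαt.comp hφ.tendsto_atTop) (fun j => hα1 _) hδpos hδα
  have hadm := ht.eventually (hadmz.eventually hkn)
  have hyΩ := hyz.eventually (hΩ.mem_nhds hzΩ)
  have hpos : ∀ᶠ j in Filter.atTop, Real.exp (-α (φ j)) < m :=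
    (hexp.comp hφ.tendsto_atTop).eventually (gt_mem_nhds hm0)
  obtain ⟨j, hj1, hj2, hj3, hj4⟩ := (hlt.and (hadm.and (hyΩ.and hpos))).exists
  set w := y (φ j) with hw
  have hwΩ : w ∈ Ω := hj3
  have hvw := hv.admissible.contDiffAt hΩ hwΩ
  have huw := hu.admissible.contDiffAt hΩ hwΩ
  have hEw : ContDiffAt ℝ 2 (E (φ j)) w := (contDiff_exp_coord i _ _).contDiffAt
  have hloc : IsLocalMax (fun y => v y + -u y + E (φ j) y) w :=
    ((hymax (φ j)).on_subset subset_closure).isLocalMax (hΩ.mem_nhds hwΩ)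
  obtain ⟨hg, hh⟩ := hessian_condition_of_isLocalMax ((hvw.add huw.neg).add hEw) hloc
  rw [gradVec_add ((hvw.add huw.neg).differentiableAt two_ne_zero)
    (hEw.differentiableAt two_ne_zero), gradVec_add (hvw.differentiableAt two_ne_zero)
    (huw.neg.differentiableAt two_ne_zero), gradVec_neg, gradVec_exp_coord] at hg
  rw [hessian_add (hvw.add huw.neg) hEw, hessian_add hvw huw.neg, hessian_neg,
    hessian_exp_coord] at hh
  have hgu : gradVec u w = gradVec v w + δ j • Pi.single i 1 := by
    have : gradVec v w + -gradVec u w + δ j • Pi.single i 1 = 0 := hg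
    rw [eq_comm, ← sub_eq_zero, ← this]
    abel
  set P := vecMulVec (Pi.single i (1 : ℝ)) (Pi.single i (1 : ℝ))
  -- At the maximum Du = Dv + δe, and D²u exceeds D²v + αδ e⊗e by S ≥ 0. Hence F(Du, D²u) is at
  -- least F at the perturbed pair, which exceeds F(Dv, D²v) ≥ ψ(w, v) ≥ ψ(w, u) = F(Du, D²u).
  set S := -(hessian v w + -hessian u w + (α (φ j) * δ j) • P) with hS
  have hSs : S.IsSymm :=
    (((isSymm_hessian hvw).add (isSymm_hessian huw).neg).add
      ((isSymm_vecMulVec_self _).smul _)).neg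
  have hSp : S.PosSemidef := by
    refine posSemidef_of_forall hSs fun ξ => ?_
    rw [hS, neg_mulVec, dotProduct_neg]
    exact neg_nonneg.2 (hh ξ)
  have hhu : hessian u w = hessian v w + (α (φ j) * δ j) • P + S := by rw [hS]; abel
  have hadmw : AdmissiblePair k (gradVec v w + δ j • Pi.single i 1)
      (hessian v w + (α (φ j) * δ j) • P) :=
    hj2 ((isSymm_hessian hvw).add ((isSymm_vecMulVec_self _).smul _))
  have hle := hadmw.le_add (l := l) hlk hkn hSp
  rw [← hhu, ← hgu, ← hu.admissible.quotientCurvature_eq hlk hkn hΩ hwΩ,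
    hu.equation w hwΩ] at hle
  have h1 := hv.inequality w hwΩ
  rw [hv.admissible.quotientCurvature_eq hlk hkn hΩ hwΩ] at h1
  have h2 : u w ≤ v w := by linarith [hlow (φ j)]
  have h3 : ψ (w, u w) ≤ ψ (w, v w) := hψ.monotone hΩ hwΩ h2
  rw [← hgu] at hj1
  linarith

end Comparison

/-! ### Gradient comparison at a smooth boundary point. -/

section Boundary

open scoped Topology

variable {n : ℕ} {Ω : Set (EuclideanSpace ℝ (Fin n))} {u v : EuclideanSpace ℝ (Fin n) → ℝ}
  {p ξ : EuclideanSpace ℝ (Fin n)}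

/-- Directions along which a defining function decreases point into the domain. -/
theorem eventually_mem_of_fderiv_neg (hp : p ∈ frontier Ω)
    {ρ : EuclideanSpace ℝ (Fin n) → ℝ} (hρ : DifferentiableAt ℝ ρ p)
    (hΩρ : ∀ᶠ x in 𝓝 p, (x ∈ Ω ↔ ρ x < 0)) (hξ : fderiv ℝ ρ p ξ < 0) :
    ∀ᶠ t : ℝ in 𝓝[>] 0, p + t • ξ ∈ Ω := by
  have hρp : ρ p ≤ 0 := by
    by_contra hcon
    push Not at hcon
    have h1 : ∀ᶠ x in 𝓝 p, 0 < ρ x := hρ.continuousAt.eventually (lt_mem_nhds hcon)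
    have h2 := (mem_closure_iff_frequently.1 (frontier_subset_closure hp))
    obtain ⟨x, hxΩ, hx1, hx2⟩ := (h2.and_eventually (h1.and hΩρ)).exists
    linarith [hx2.1 hxΩ]
  have hρ0 : DifferentiableAt ℝ ρ (p + (0 : ℝ) • ξ) := by simpa using hρ
  have hd := hasDerivAt_line hρ0
  rw [zero_smul, add_zero] at hd
  rw [hasDerivAt_iff_tendsto_slope_zero] at hd
  have hneg := (hd.mono_left (nhdsGT_le_nhdsNE 0)).eventually (gt_mem_nhds hξ)
  have hline := (eventually_line hΩρ ξ).filter_mono (nhdsWithin_le_nhds (s := Set.Ioi 0))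
  filter_upwards [hneg, hline, self_mem_nhdsWithin] with t h1 h2 h3
  rw [h2]
  have ht : (0 : ℝ) < t := h3
  simp only [zero_add, zero_smul, add_zero, smul_eq_mul] at h1
  have h4 := (mul_neg_iff.1 h1).resolve_right fun h => by
    linarith [inv_pos.2 ht, h.1]
  linarith [h4.2]

/-- One-sided directional derivatives at boundary points are given by the extended gradient. -/
theorem IsC1UpToBoundary.hasDerivWithinAt_line (hΩ : IsOpen Ω) (hu : IsC1UpToBoundary Ω u)
    (hp : p ∈ closure Ω) (hξ : ∀ᶠ t : ℝ in 𝓝[>] 0, p + t • ξ ∈ Ω) :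
    HasDerivWithinAt (fun t : ℝ => u (p + t • ξ)) (inner ℝ (gradBar Ω u p) ξ) (Set.Ici 0) 0 := by
  have hdiff : ∀ t : ℝ, p + t • ξ ∈ Ω →
      HasDerivAt (fun t : ℝ => u (p + t • ξ)) (inner ℝ (gradient u (p + t • ξ)) ξ) t := by
    intro t ht
    rw [inner_gradient_left]
    exact hasDerivAt_line
      ((hu.contDiffOn.contDiffAt (hΩ.mem_nhds ht)).differentiableAt one_ne_zero)
  have hpath : Filter.Tendsto (fun t : ℝ => p + t • ξ) (𝓝[>] 0) (𝓝 p) := by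
    have hc : ContinuousAt (fun t : ℝ => p + t • ξ) 0 := by fun_prop
    have := hc.tendsto
    simp only [zero_smul, add_zero] at this
    exact this.mono_left nhdsWithin_le_nhds
  refine hasDerivWithinAt_Ici_of_tendsto_deriv (s := {t : ℝ | p + t • ξ ∈ Ω}) ?_ ?_ hξ ?_
  · exact fun t ht => (hdiff t ht).differentiableAt.differentiableWithinAt
  · have h1 : ContinuousWithinAt u (closure Ω) (p + (0 : ℝ) • ξ) := by
      simpa using hu.continuousOn p hp
    refine h1.comp (f := fun t : ℝ => p + t • ξ) (by fun_prop) fun t ht => subset_closure ht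
  · have hlim : Filter.Tendsto (gradient u) (𝓝[Ω] p) (𝓝 (gradBar Ω u p)) :=
      tendsto_extendFrom (hu.exists_limit p hp)
    have h2 := hlim.comp (tendsto_nhdsWithin_iff.2 ⟨hpath, hξ⟩)
    have h3 := Filter.Tendsto.inner (𝕜 := ℝ) h2 (tendsto_const_nhds (x := ξ))
    refine h3.congr' ?_
    filter_upwards [hξ] with t ht
    exact (hdiff t ht).deriv.symm

theorem derivWithin_nonpos_of_le {g : ℝ → ℝ} {e : ℝ} (hg : HasDerivWithinAt g e (Set.Ici 0) 0)
    (h : ∀ᶠ t in 𝓝[>] (0 : ℝ), g t ≤ g 0) : e ≤ 0 := by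
  have h1 := (hasDerivWithinAt_iff_tendsto_slope' (Set.self_notMem_Ioi (a := (0 : ℝ)))).1
    (hg.mono Set.Ioi_subset_Ici_self)
  refine le_of_tendsto h1 ?_
  filter_upwards [h, self_mem_nhdsWithin] with t ht ht0
  have : (0 : ℝ) < t := ht0
  rw [slope_def_field]
  exact div_nonpos_of_nonpos_of_nonneg (by linarith) (by linarith)

/-- Here N plays the outer normal, a = Du and b = Dv. The sign condition on the open half-space
forces a = cN with c ≥ 0, and testing the second condition with -N gives |a||N| = a·N ≤ b·N ≤
|b||N|. -/
theorem norm_le_norm_of_halfspace {F : Type*} [NormedAddCommGroup F] [InnerProductSpace ℝ F]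
    {N a b : F} (hN : N ≠ 0) (ha : ∀ ξ, inner ℝ N ξ < 0 → inner ℝ a ξ ≤ 0)
    (hb : ∀ ξ, inner ℝ N ξ < 0 → inner ℝ b ξ ≤ inner ℝ a ξ) : ‖a‖ ≤ ‖b‖ := by
  have hNN : 0 < inner ℝ N N := real_inner_self_pos.2 hN
  have hNneg : inner ℝ N (-N) < 0 := by rw [inner_neg_right]; linarith
  have hn : 0 < ‖N‖ := norm_pos_iff.2 hN
  have haN : 0 ≤ inner ℝ a N := by
    have := ha (-N) hNneg
    rw [inner_neg_right] at this; linarith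
  have habN : inner ℝ a N ≤ inner ℝ b N := by
    have := hb (-N) hNneg
    rw [inner_neg_right, inner_neg_right] at this; linarith
  have htan : ∀ w, inner ℝ N w = 0 → inner ℝ a w ≤ 0 := by
    intro w hw
    by_contra hcon
    push Not at hcon
    -- Tilting w inwards by sN enters the half-space, yet keeps the pairing with a positive because
    -- s(a·N) ≤ (a·w)/2.
    set s := inner ℝ a w / (inner ℝ a N + 1) / 2
    have hs : 0 < s := by positivity
    have h1 := ha (w - s • N) (by
      rw [inner_sub_right, inner_smul_right, hw]
      nlinarith)
    rw [inner_sub_right, inner_smul_right] at h1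
    have h2 : s * (inner ℝ a N + 1) = inner ℝ a w / 2 := by
      simp only [s]; field_simp
    nlinarith
  set c := inner ℝ a N / inner ℝ N N with hc
  set w := a - c • N with hw
  have hNw : inner ℝ N w = 0 := by
    rw [hw, inner_sub_right, inner_smul_right, real_inner_comm a N, hc]
    field_simp
    ring
  have hw0 : w = 0 := by
    have h1 := htan w hNw
    have h2 : inner ℝ a w = inner ℝ w w := by
      have : a = w + c • N := by rw [hw]; abel
      conv_lhs => rw [this]
      rw [inner_add_left, inner_smul_left, hNw]; simp
    rw [h2] at h1
    exact inner_self_eq_zero.1 (le_antisymm h1 real_inner_self_nonneg)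
  have hac : a = c • N := sub_eq_zero.1 hw0
  have hc0 : 0 ≤ c := div_nonneg haN hNN.le
  have h1 : ‖a‖ * ‖N‖ = inner ℝ a N := by
    conv_rhs => rw [hac]
    rw [hac, norm_smul, Real.norm_of_nonneg hc0, inner_smul_left, real_inner_self_eq_norm_sq]
    simp only [conj_trivial]
    ring
  have h2 : ‖a‖ * ‖N‖ ≤ ‖b‖ * ‖N‖ := by
    rw [h1]
    exact habN.trans (real_inner_le_norm b N)
  exact le_of_mul_le_mul_right h2 hn

/-- If `v ≤ u ≤ 0` with equality at a smooth boundary point, then `|Du| ≤ |Dv|` there. -/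
theorem norm_gradBar_le_of_le (hΩ : IsOpen Ω) (hs : HasSmoothBoundary Ω)
    (hu : IsC1UpToBoundary Ω u) (hv : IsC1UpToBoundary Ω v) (hp : p ∈ frontier Ω)
    (hu0 : u p = 0) (hv0 : v p = 0) (huneg : ∀ x ∈ Ω, u x ≤ 0) (hvu : ∀ x ∈ Ω, v x ≤ u x) :
    ‖gradBar Ω u p‖ ≤ ‖gradBar Ω v p‖ := by
  obtain ⟨ρ, hρ, hρp, hΩρ⟩ := hs p hp
  have hρd : DifferentiableAt ℝ ρ p := hρ.contDiffAt.differentiableAt (by simp)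
  have hpc := frontier_subset_closure hp
  have hN : gradient ρ p ≠ 0 := by
    intro h
    apply hρp
    ext ξ
    rw [← inner_gradient_left, h]
    simp
  have key : ∀ ξ, inner ℝ (gradient ρ p) ξ < 0 → ∀ᶠ t : ℝ in 𝓝[>] 0, p + t • ξ ∈ Ω := by
    intro ξ hξ
    rw [inner_gradient_left] at hξ
    exact eventually_mem_of_fderiv_neg hp hρd hΩρ hξ
  refine norm_le_norm_of_halfspace hN (fun ξ hξ => ?_) fun ξ hξ => ?_
  · refine derivWithin_nonpos_of_le (hu.hasDerivWithinAt_line hΩ hpc (key ξ hξ)) ?_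
    filter_upwards [key ξ hξ] with t ht
    simpa [hu0] using huneg _ ht
  · have h := (hv.hasDerivWithinAt_line hΩ hpc (key ξ hξ)).sub
      (hu.hasDerivWithinAt_line hΩ hpc (key ξ hξ))
    refine sub_nonpos.1 (derivWithin_nonpos_of_le h ?_)
    filter_upwards [key ξ hξ] with t ht
    simpa [hu0, hv0] using hvu _ ht

end Boundary

/-! ### Bounds on the source and the estimate with a subsolution. -/

section SourceBounds

open scoped Topology

variable {n : ℕ} {Ω : Set (EuclideanSpace ℝ (Fin n))}
  {ψ : EuclideanSpace ℝ (Fin n) × ℝ → ℝ}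

theorem IsMonotoneSource.exists_lower_bound (hb : Bornology.IsBounded Ω)
    (hψ : IsMonotoneSource Ω ψ) (M : ℝ) :
    ∃ c : ℝ, 0 < c ∧ ∀ x ∈ Ω, ∀ z : ℝ, |z| ≤ M → c ≤ ψ (x, z) := by
  have hcomp : IsCompact (closure Ω ×ˢ Set.Icc (-M) M) := (isCompact_closure hb).prod isCompact_Icc
  rcases (closure Ω ×ˢ Set.Icc (-M) M).eq_empty_or_nonempty with he | hne
  · refine ⟨1, one_pos, fun x hx z hz => ?_⟩
    have : (x, z) ∈ closure Ω ×ˢ Set.Icc (-M) M := ⟨subset_closure hx, abs_le.1 hz⟩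
    rw [he] at this
    exact this.elim
  · obtain ⟨y, hy, hmin⟩ := hcomp.exists_isMinOn hne
      (hψ.smooth.continuousOn.mono (Set.prod_mono subset_rfl (Set.subset_univ _)))
    exact ⟨ψ y, hψ.pos y.1 hy.1 y.2, fun x hx z hz => hmin ⟨subset_closure hx, abs_le.1 hz⟩⟩

/-- On the closure of an arbitrary open set the derivative of ψ need not be unique at boundary
points. Near each point some derivative within the closure is continuous, hence locally bounded, and
over Ω it agrees with the full derivative. Compactness patches the local bounds. -/
theorem IsMonotoneSource.exists_gradient_bound (hΩ : IsOpen Ω) (hb : Bornology.IsBounded Ω)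
    (hψ : IsMonotoneSource Ω ψ) (M : ℝ) :
    ∃ K : ℝ, ∀ x ∈ Ω, ∀ z : ℝ, |z| ≤ M → ‖gradient (fun y => ψ (y, z)) x‖ ≤ K := by
  have hcomp : IsCompact (closure Ω ×ˢ Set.Icc (-M) M) := (isCompact_closure hb).prod isCompact_Icc
  obtain ⟨K, hK⟩ : ∃ K : ℝ, ∀ y ∈ closure Ω ×ˢ Set.Icc (-M) M, y.1 ∈ Ω →
      ‖fderiv ℝ ψ y‖ ≤ K := by
    refine hcomp.induction_on (p := fun t => ∃ K : ℝ, ∀ y ∈ t, y.1 ∈ Ω → ‖fderiv ℝ ψ y‖ ≤ K)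
      ⟨0, by simp⟩ (fun s t hst ⟨K, hK⟩ => ⟨K, fun y hy => hK y (hst hy)⟩) ?_ ?_
    · rintro s t ⟨K, hK⟩ ⟨K', hK'⟩
      refine ⟨max K K', fun y hy hyΩ => ?_⟩
      rcases hy with hy | hy
      · exact (hK y hy hyΩ).trans (le_max_left _ _)
      · exact (hK' y hy hyΩ).trans (le_max_right _ _)
    · intro y hy
      have hyS : y ∈ closure Ω ×ˢ (Set.univ : Set ℝ) := ⟨hy.1, trivial⟩
      have h1 : ContDiffWithinAt ℝ (0 + 1) ψ (closure Ω ×ˢ Set.univ) y :=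
        (hψ.smooth y hyS).of_le (by rw [zero_add]; exact_mod_cast le_top)
      obtain ⟨U, hU, -, -, f', hf', hc⟩ :=
        (contDiffWithinAt_succ_iff_hasFDerivWithinAt' (by simp)).1 h1
      rw [Set.insert_eq_of_mem hyS] at hU
      have h2 := hc.continuousWithinAt.norm.eventually
        (gt_mem_nhds (show ‖f' y‖ < ‖f' y‖ + 1 by linarith))
      refine ⟨{w | w ∈ U ∧ ‖f' w‖ < ‖f' y‖ + 1},
        nhdsWithin_mono y (Set.prod_mono subset_rfl (Set.subset_univ _))
          (Filter.inter_mem hU h2), ‖f' y‖ + 1, fun w hw hwΩ => ?_⟩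
      have hnhds : closure Ω ×ˢ (Set.univ : Set ℝ) ∈ 𝓝 w :=
        Filter.mem_of_superset ((hΩ.prod isOpen_univ).mem_nhds ⟨hwΩ, trivial⟩)
          (Set.prod_mono subset_closure subset_rfl)
      rw [((hf' w hw.1).hasFDerivAt hnhds).fderiv]
      exact hw.2.le
  refine ⟨K, fun x hx z hz => ?_⟩
  have hd := ((hψ.contDiffAt hΩ hx z).differentiableAt one_ne_zero).hasFDerivAt
  have hx' : HasFDerivAt (fun y : EuclideanSpace ℝ (Fin n) => (y, z))
      (ContinuousLinearMap.inl ℝ (EuclideanSpace ℝ (Fin n)) ℝ) x := hasFDerivAt_prodMk_left x z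
  have hcomp' : HasFDerivAt (fun y => ψ (y, z)) _ x := hd.comp x hx'
  rw [gradient, LinearIsometryEquiv.norm_map, hcomp'.fderiv]
  refine (ContinuousLinearMap.opNorm_comp_le _ _).trans ?_
  refine (mul_le_of_le_one_right (norm_nonneg _)
    (ContinuousLinearMap.norm_inl_le_one ℝ (EuclideanSpace ℝ (Fin n)) ℝ)).trans ?_
  exact hK (x, z) ⟨subset_closure hx, abs_le.1 hz⟩ hx

/-- The uniform spacelike bound in the presence of an admissible subsolution. -/
theorem spacelike_estimate_of_subsolution {k l : ℕ} (hk : 2 ≤ k) (hlk : l < k) (hkn : k ≤ n)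
    {v : EuclideanSpace ℝ (Fin n) → ℝ} (hΩ : IsOpen Ω) (hb : Bornology.IsBounded Ω)
    (hs : HasSmoothBoundary Ω) (hψ : IsMonotoneSource Ω ψ)
    (hv : IsAdmissibleSubsolution k l Ω ψ v) : ∃ θ₀ : ℝ, 0 < θ₀ ∧ θ₀ < 1 ∧
      ∀ u : EuclideanSpace ℝ (Fin n) → ℝ, ContDiffOn ℝ 3 u Ω → IsAdmissibleSolution k l Ω ψ u →
        ∀ x ∈ closure Ω, ‖gradBar Ω u x‖ ≤ 1 - θ₀ := by
  obtain ⟨M, hM⟩ := (isCompact_closure hb).exists_bound_of_continuousOn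
    hv.admissible.isC1.continuousOn
  obtain ⟨c, hc, hcb⟩ := hψ.exists_lower_bound hb M
  obtain ⟨K, hK⟩ := hψ.exists_gradient_bound hΩ hb M
  obtain ⟨s, hs1, hsb⟩ := hv.admissible.spacelike
  -- The minimum with 1/2 keeps θ < 1 even when the bound s on |Dv| is 0. The bound M on |v| serves
  -- for u, since v ≤ u ≤ 0.
  obtain ⟨θ₀, h0, h1, hest⟩ := spacelike_estimate (n := n) hlk hkn K c M (min (1 - s) (1 / 2)) hc
    (lt_min (by linarith) (by norm_num)) ((min_le_right _ _).trans_lt (by norm_num))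
  refine ⟨θ₀, h0, h1, fun u hu3 hu => ?_⟩
  have hneg : ∀ x ∈ closure Ω, u x ≤ 0 := fun x hx =>
    hu.admissible.nonpos (by omega) hkn hΩ hb hu.boundary hx
  have hcomp : ∀ x ∈ closure Ω, v x ≤ u x := fun x hx =>
    subsolution_le hlk hkn (by omega) hΩ hb hψ hu hv hx
  refine hest Ω ψ u hΩ hb hψ hu3 hu ⟨fun x hx => ?_, hK, hcb⟩ fun x hx => ?_
  · have h2 := hM x hx
    rw [Real.norm_eq_abs] at h2
    rw [abs_of_nonpos (hneg x hx)]
    linarith [hcomp x hx, (abs_le.1 h2).1]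
  · refine (norm_gradBar_le_of_le hΩ hs hu.admissible.isC1 hv.admissible.isC1 hx
      (hu.boundary x hx) (hv.boundary x hx) (fun y hy => hneg y (subset_closure hy))
      (fun y hy => hcomp y (subset_closure hy))).trans ?_
    refine (hsb x (frontier_subset_closure hx)).trans ?_
    linarith [min_le_left (1 - s) (1 / 2 : ℝ)]

end SourceBounds

end MinkowskiGraph

theorem theorem3p1 {n k l : ℕ} (hk : 2 ≤ k) (hlk : l < k) (hkn : k < n) :
    -- the gradient estimate, with a constant depending only on `n, k, l, K, c, M`
    (∀ K c M : ℝ, 0 < c → ∃ C : ℝ, 0 < C ∧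
      ∀ (Ω : Set (EuclideanSpace ℝ (Fin n))) (ψ : EuclideanSpace ℝ (Fin n) × ℝ → ℝ)
        (u : EuclideanSpace ℝ (Fin n) → ℝ),
        IsOpen Ω → Bornology.IsBounded Ω → MinkowskiGraph.IsMonotoneSource Ω ψ →
        ContDiffOn ℝ 3 u Ω → MinkowskiGraph.IsAdmissibleSolution k l Ω ψ u →
        MinkowskiGraph.HasBounds K c M Ω ψ u →
        ∀ x ∈ closure Ω, MinkowskiGraph.wTilde Ω u x ≤
          C * (1 + sSup (MinkowskiGraph.wTilde Ω u '' frontier Ω))) ∧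
    -- the spacelike bound in terms of the boundary gradient bound
    (∀ K c M θ : ℝ, 0 < c → 0 < θ → θ < 1 → ∃ θ₀ : ℝ, 0 < θ₀ ∧ θ₀ < 1 ∧
      ∀ (Ω : Set (EuclideanSpace ℝ (Fin n))) (ψ : EuclideanSpace ℝ (Fin n) × ℝ → ℝ)
        (u : EuclideanSpace ℝ (Fin n) → ℝ),
        IsOpen Ω → Bornology.IsBounded Ω → MinkowskiGraph.IsMonotoneSource Ω ψ →
        ContDiffOn ℝ 3 u Ω → MinkowskiGraph.IsAdmissibleSolution k l Ω ψ u →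
        MinkowskiGraph.HasBounds K c M Ω ψ u →
        (∀ x ∈ frontier Ω, ‖MinkowskiGraph.gradBar Ω u x‖ ≤ 1 - θ) →
        ∀ x ∈ closure Ω, ‖MinkowskiGraph.gradBar Ω u x‖ ≤ 1 - θ₀) ∧
    -- the uniform spacelike bound for the Dirichlet problem with an admissible subsolution
    (∀ (Ω : Set (EuclideanSpace ℝ (Fin n))) (ψ : EuclideanSpace ℝ (Fin n) × ℝ → ℝ)
      (v : EuclideanSpace ℝ (Fin n) → ℝ),
      IsOpen Ω → Bornology.IsBounded Ω → MinkowskiGraph.HasSmoothBoundary Ω →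
      MinkowskiGraph.IsMonotoneSource Ω ψ → MinkowskiGraph.IsAdmissibleSubsolution k l Ω ψ v →
      ∃ θ₀ : ℝ, 0 < θ₀ ∧ θ₀ < 1 ∧
        ∀ u : EuclideanSpace ℝ (Fin n) → ℝ,
          ContDiffOn ℝ 3 u Ω → MinkowskiGraph.IsAdmissibleSolution k l Ω ψ u →
          ∀ x ∈ closure Ω, ‖MinkowskiGraph.gradBar Ω u x‖ ≤ 1 - θ₀) := by
  exact ⟨fun K c M hc => MinkowskiGraph.gradient_estimate hlk hkn.le K c M hc,
    fun K c M θ hc hθ hθ1 => MinkowskiGraph.spacelike_estimate hlk hkn.le K c M θ hc hθ hθ1,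
    fun Ω ψ v hΩ hb hs hψ hv =>
      MinkowskiGraph.spacelike_estimate_of_subsolution hk hlk hkn.le hΩ hb hs hψ hv⟩
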